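/- **Setting.** Let $\mathcal X\subseteq\mathbb R^d$ with a probability measure $P_X$, and let $K$ be a kernel on $\mathcal X$ with the (pointwise convergent) Mercer expansion $K(x,x')=\sum_{i\ge1}\mu_i\phi_i(x)\phi_i(x')$, where $\mu_1\ge\mu_2\ge\cdots>0$, the $\phi_i$ are orthonormal in $L^2(P_X)$, $\sup_i\|\phi_i\|_{\sup}<\infty$, $\sum_i\mu_i<\infty$ and $\sup_{k\ge1}\sum_{i>k}\mu_i/(k\mu_k)<\infty$. One observes $y_i=f(x_i)+\epsilon_i$, $i=1,\dots,n$, where the $x_i$ are i.i.d. with law $P_X$ and the $\epsilon_i$ are i.i.d. $N(0,1)$. Let $S=S_n$ be a random real $s\times n$ matrix ($s=s_n$), possibly dependent on $\boldsymbol x=(x_1,\dots,x_n)$, such that the noise $(\epsilon_1,\dots,\epsilon_n)$ is independent of $(\boldsymbol x,S)$. Let $\lambda=\lambda_n>0$, $\boldsymbol K=[n^{-1}K(x_i,x_j)]_{i,j\le n}$, and $$\Delta=\boldsymbol KS^\top(S\boldsymbol K^2S^\top+\lambda S\boldsymbol KS^\top)^{-1}S\boldsymbol K .$$ Let $\boldsymbol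 X$ be the $(d+1)\times n$ matrix with columns $(1,x_i^\top)^\top$ and $H=\boldsymbol X^\top(\boldsymbol X\boldsymbol X^\top)^{-1}\boldsymbol X$. With the residualized responses $\boldsymbol y^*=(I-H)\boldsymbol y$ put $$\widehat\beta^*=\tfrac1n(S\boldsymbol K^2S^\top+\lambda S\boldsymbol KS^\top)^{-1}S\boldsymbol K\boldsymbol y^*,\quad \widehat f_R^*(\cdot)=\sum_{i=1}^n(S^\top\widehat\beta^*)_iK(x_i,\cdot),\quad T^*_{n,\lambda}=\frac1n\sum_{i=1}^n\widehat f_R^*(x_i)^2 .$$ Let $G_n$ be the event that the two inverses above exist, and assume $P(G_n)\to1$; off $G_n$ a missing inverse is read as $0$, as is a quotient with denominator $0$. **Assumption on $S$.** Let $s_\lambda$ be the number of $\mu_i$ greater than $\lambda$, and let $\boldsymbol K=UDU^\top$ be a spectral decomposition with eigenvalues in nonincreasing order, $U=(U_1,U_2)$, $D=\mathrm{diag}(D_1,D_2)$, where $U_1,D_1$ correspond to the eigenvalues greater than $\lambda$. There are constants $c_0,c>0$ and $c_1,c_2\in(0,\infty]$, not depending on $n$, such that for all large $n$: $s\ge c_0s_\lambda$,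 and the event $$\mathcal E_n=\{\|(SU_1)^\top SU_1-I\|_{\rm op}\le 1/2,\ \|SU_2D_2^{1/2}\|_{\rm op}\le c\lambda^{1/2}\}$$ satisfies $P\big(P(\mathcal E_n\mid\boldsymbol x)\ge1-e^{-c_1s}\big)\ge1-e^{-c_2s_\lambda}$. **Theorem 4.5.** Suppose that $\lambda\to0$ and $s\to\infty$ as $n\to\infty$. Then under $H_0^{\rm linear}$, that is, if $f(x)=\beta_0+\beta_1^\top x$ on $\mathcal X$ for some $\beta_0\in\mathbb R$, $\beta_1\in\mathbb R^d$, $$\frac{T^*_{n,\lambda}-\mu^*_{n,\lambda}}{\sigma^*_{n,\lambda}}\xrightarrow{d}N(0,1),\qquad \mu^*_{n,\lambda}=\frac{\operatorname{tr}((I-H)\Delta^2(I-H))}{n},\quad \sigma^*_{n,\lambda}=\frac{\sqrt{2\operatorname{tr}((I-H)\Delta^4(I-H))}}{n}.$$ Moreover, for every $n$, almost surely $E\{T^*_{n,\lambda}\mathbf 1_{G_n}\mid\boldsymbol x,S\}=\mu^*_{n,\lambda}\mathbf 1_{G_n}$ and $\operatorname{Var}(T^*_{n,\lambda}\mathbf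 1_{G_n}\mid\boldsymbol x,S)=v_{n,\lambda}\mathbf 1_{G_n}$ with $v_{n,\lambda}=2\operatorname{tr}\big([(I-H)\Delta^2(I-H)]^2\big)/n^2$, and also $(T^*_{n,\lambda}-\mu^*_{n,\lambda})/\sqrt{v_{n,\lambda}}\xrightarrow{d}N(0,1)$. -/

import Mathlib

open MeasureTheory ProbabilityTheory Filter Topology
open scoped Matrix ENNReal

noncomputable section

namespace SketchedKRR

/-- `K` is a kernel on `𝒳` with Mercer expansion `K(x, x') = ∑ μ_i φ_i(x) φ_i(x')`, where the
`μ_i` are positive and nonincreasing and the `φ_i` are orthonormal in `L²(P_X)`.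
The indices start at `0`, so `ev 0` is the largest eigenvalue. -/
structure IsMercerExpansion {𝒳 : Type*} [MeasurableSpace 𝒳] (PX : Measure 𝒳)
    (K : 𝒳 → 𝒳 → ℝ) (ev : ℕ → ℝ) (φ : ℕ → 𝒳 → ℝ) : Prop where
  ev_pos : ∀ i, 0 < ev i
  ev_antitone : Antitone ev
  measurable : ∀ i, Measurable (φ i)
  memLp : ∀ i, MemLp (φ i) 2 PX
  orthonormal : ∀ i j, ∫ x, φ i x * φ j x ∂PX = if i = j then 1 else 0
  expansion : ∀ x x', HasSum (fun i => ev i * φ i x * φ i x') (K x x')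

/-- The eigenfunctions are uniformly bounded, and `sup_{k ≥ 1} (∑_{i > k} μ_i) / (k μ_k) < ∞`
(here `μ_k` is `ev (k - 1)`, and `k` is written `m + 1`). -/
structure IsRegularExpansion {𝒳 : Type*} (ev : ℕ → ℝ) (φ : ℕ → 𝒳 → ℝ) : Prop where
  bounded : ∃ C : ℝ, ∀ i x, |φ i x| ≤ C
  summable : Summable ev
  tail : ∃ C : ℝ, ∀ m : ℕ, ∑' j, ev (m + 1 + j) ≤ C * ((m + 1 : ℕ) * ev m)

/-- `s_λ`: the number of population eigenvalues greater than `λ`. -/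
def popDim (ev : ℕ → ℝ) (lam : ℝ) : ℕ := {i | lam < ev i}.ncard

/-- The empirical kernel matrix `[n⁻¹ K(x_i, x_j)]`. -/
def kernelMatrix {𝒳 : Type*} {n : ℕ} (K : 𝒳 → 𝒳 → ℝ) (x : Fin n → 𝒳) :
    Matrix (Fin n) (Fin n) ℝ :=
  Matrix.of fun i j => (n : ℝ)⁻¹ * K (x i) (x j)

/-- The `s × s` matrix `S K² Sᵀ + λ S K Sᵀ`. -/
def gramMatrix {n s : ℕ} (A : Matrix (Fin n) (Fin n) ℝ) (S : Matrix (Fin s) (Fin n) ℝ)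
    (lam : ℝ) : Matrix (Fin s) (Fin s) ℝ :=
  S * A ^ 2 * Sᵀ + lam • (S * A * Sᵀ)

/-- The sketched ridge objective `βᵀ(SK)(KSᵀ)β - (2/n) βᵀSKy + λ βᵀSKSᵀβ`. -/
def objective {n s : ℕ} (A : Matrix (Fin n) (Fin n) ℝ) (S : Matrix (Fin s) (Fin n) ℝ)
    (lam : ℝ) (y : Fin n → ℝ) (b : Fin s → ℝ) : ℝ :=
  b ⬝ᵥ ((S * A) * (A * Sᵀ)) *ᵥ b - 2 / n * (b ⬝ᵥ (S * A) *ᵥ y) + lam * (b ⬝ᵥ (S * A * Sᵀ) *ᵥ b)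

/-- The sketched coefficients `β̂ = n⁻¹ (S K² Sᵀ + λ S K Sᵀ)⁻¹ S K y`. -/
def coef {n s : ℕ} (A : Matrix (Fin n) (Fin n) ℝ) (S : Matrix (Fin s) (Fin n) ℝ)
    (lam : ℝ) (y : Fin n → ℝ) : Fin s → ℝ :=
  (n : ℝ)⁻¹ • ((gramMatrix A S lam)⁻¹ * S * A) *ᵥ y

/-- Where the inverse exists, the coefficients minimize the sketched ridge objective. -/
theorem objective_coef_le {n s : ℕ} (A : Matrix (Fin n) (Fin n) ℝ) (hA : A.PosSemidef)
    (S : Matrix (Fin s) (Fin n) ℝ) (lam : ℝ) (hlam : 0 < lam)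
    (hM : IsUnit (gramMatrix A S lam).det) (y : Fin n → ℝ) (b : Fin s → ℝ) :
    objective A S lam y (coef A S lam y) ≤ objective A S lam y b := by
  set M := gramMatrix A S lam with hMdef
  set c := coef A S lam y with hc
  have hAt : Aᵀ = A := by simpa using hA.isHermitian.eq
  have hMt : Mᵀ = M := by
    rw [hMdef, gramMatrix, pow_two]
    simp [Matrix.transpose_mul, hAt, Matrix.mul_assoc]
  have hMpsd : M.PosSemidef := by
    rw [hMdef, gramMatrix]
    have h1 : (S * A ^ 2 * Sᵀ).PosSemidef := by
      have := (hA.pow 2).mul_mul_conjTranspose_same S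
      simpa using this
    have h2 : (S * A * Sᵀ).PosSemidef := by
      have := hA.mul_mul_conjTranspose_same S
      simpa using this
    exact h1.add (h2.smul hlam.le)
  have hobj : ∀ v, objective A S lam y v
      = v ⬝ᵥ M *ᵥ v - 2 * (v ⬝ᵥ M *ᵥ c) := by
    intro v
    have hMc : M *ᵥ c = (n : ℝ)⁻¹ • (S * A) *ᵥ y := by
      rw [hc, coef, Matrix.mulVec_smul, Matrix.mulVec_mulVec, Matrix.mul_assoc,
        ← Matrix.mul_assoc _ _ (S * A), ← hMdef, Matrix.mul_nonsing_inv _ hM, Matrix.one_mul]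
    rw [hMc, objective, hMdef, gramMatrix]
    simp only [Matrix.smul_mulVec, dotProduct_smul, Matrix.add_mulVec, dotProduct_add,
      smul_eq_mul, pow_two, Matrix.mul_assoc]
    ring
  have hpos := hMpsd.dotProduct_mulVec_nonneg (b - c)
  have hsymm : c ⬝ᵥ M *ᵥ b = b ⬝ᵥ M *ᵥ c := by
    rw [Matrix.dotProduct_mulVec, ← Matrix.mulVec_transpose, hMt, dotProduct_comm]
  simp only [star_trivial, Matrix.mulVec_sub, dotProduct_sub, sub_dotProduct] at hpos
  rw [hobj, hobj]
  linarith

/-- The sketched estimator `f̂_R = ∑ (Sᵀβ̂)_i K(x_i, ·)` fitted to the responses `y`. -/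
def estimator {𝒳 : Type*} {n s : ℕ} (K : 𝒳 → 𝒳 → ℝ) (x : Fin n → 𝒳)
    (S : Matrix (Fin s) (Fin n) ℝ) (lam : ℝ) (y : Fin n → ℝ) (t : 𝒳) : ℝ :=
  ∑ i, (Sᵀ *ᵥ coef (kernelMatrix K x) S lam y) i * K (x i) t

/-- The squared empirical norm `‖g‖_n²`. -/
def empNormSq {𝒳 : Type*} {n : ℕ} (x : Fin n → 𝒳) (g : 𝒳 → ℝ) : ℝ :=
  (n : ℝ)⁻¹ * ∑ i, g (x i) ^ 2

/-- The smoothing matrix `Δ = K Sᵀ (S K² Sᵀ + λ S K Sᵀ)⁻¹ S K`. -/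
def smoother {n s : ℕ} (A : Matrix (Fin n) (Fin n) ℝ) (S : Matrix (Fin s) (Fin n) ℝ)
    (lam : ℝ) : Matrix (Fin n) (Fin n) ℝ :=
  A * Sᵀ * (gramMatrix A S lam)⁻¹ * S * A

/-- The `(d + 1) × n` design matrix, with columns `(1, x_i)`. -/
def design {d n : ℕ} {𝒳 : Set (EuclideanSpace ℝ (Fin d))} (x : Fin n → 𝒳) :
    Matrix (Fin (d + 1)) (Fin n) ℝ :=
  Matrix.of fun a i => (Fin.cons 1 (fun j => (x i : EuclideanSpace ℝ (Fin d)) j) :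
    Fin (d + 1) → ℝ) a

/-- The hat matrix `H = Xᵀ (X Xᵀ)⁻¹ X`. -/
def hat {d n : ℕ} {𝒳 : Set (EuclideanSpace ℝ (Fin d))} (x : Fin n → 𝒳) :
    Matrix (Fin n) (Fin n) ℝ :=
  (design x)ᵀ * (design x * (design x)ᵀ)⁻¹ * design x

/-- `f` is a linear function `x ↦ β₀ + β₁ᵀ x` on `𝒳`. -/
def IsLinearFun {d : ℕ} {𝒳 : Set (EuclideanSpace ℝ (Fin d))} (f : 𝒳 → ℝ) : Prop :=
  ∃ (b0 : ℝ) (b1 : EuclideanSpace ℝ (Fin d)), ∀ x : 𝒳,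
    f x = b0 + ∑ j, b1 j * (x : EuclideanSpace ℝ (Fin d)) j

/-- The statistic `T* = ‖f̂_R*‖_n²`, where `f̂_R*` is fitted to the residuals `y* = (I - H) y`. -/
def linStat {d n s : ℕ} {𝒳 : Set (EuclideanSpace ℝ (Fin d))} (K : 𝒳 → 𝒳 → ℝ) (x : Fin n → 𝒳)
    (S : Matrix (Fin s) (Fin n) ℝ) (lam : ℝ) (y : Fin n → ℝ) : ℝ :=
  empNormSq x (estimator K x S lam ((1 - hat x) *ᵥ y))

/-- `μ* = tr((I - H) Δ² (I - H)) / n`. -/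
def linMean {d n s : ℕ} {𝒳 : Set (EuclideanSpace ℝ (Fin d))} (K : 𝒳 → 𝒳 → ℝ) (x : Fin n → 𝒳)
    (S : Matrix (Fin s) (Fin n) ℝ) (lam : ℝ) : ℝ :=
  ((1 - hat x) * smoother (kernelMatrix K x) S lam ^ 2 * (1 - hat x)).trace / n

/-- `σ* = √(2 tr((I - H) Δ⁴ (I - H))) / n`. -/
def linSD {d n s : ℕ} {𝒳 : Set (EuclideanSpace ℝ (Fin d))} (K : 𝒳 → 𝒳 → ℝ) (x : Fin n → 𝒳)
    (S : Matrix (Fin s) (Fin n) ℝ) (lam : ℝ) : ℝ :=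
  √(2 * ((1 - hat x) * smoother (kernelMatrix K x) S lam ^ 4 * (1 - hat x)).trace) / n

/-- The exact conditional variance `2 tr(((I - H) Δ² (I - H))²) / n²` of the statistic. -/
def linVar {d n s : ℕ} {𝒳 : Set (EuclideanSpace ℝ (Fin d))} (K : 𝒳 → 𝒳 → ℝ) (x : Fin n → 𝒳)
    (S : Matrix (Fin s) (Fin n) ℝ) (lam : ℝ) : ℝ :=
  2 * (((1 - hat x) * smoother (kernelMatrix K x) S lam ^ 2 * (1 - hat x)) ^ 2).trace / n ^ 2

/-- The two inverses in the definition of the statistic exist. -/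
def IsWellPosed {d n s : ℕ} {𝒳 : Set (EuclideanSpace ℝ (Fin d))} (K : 𝒳 → 𝒳 → ℝ)
    (x : Fin n → 𝒳) (S : Matrix (Fin s) (Fin n) ℝ) (lam : ℝ) : Prop :=
  IsUnit (design x * (design x)ᵀ).det ∧ IsUnit (gramMatrix (kernelMatrix K x) S lam).det

/-- The operator norm `max ‖Av‖₂ / ‖v‖₂` of a matrix. -/
def opNorm {m n : Type*} [Fintype m] [Fintype n] [DecidableEq n] (A : Matrix m n ℝ) : ℝ :=
  ‖LinearMap.toContinuousLinearMap (Matrix.toEuclideanLin A)‖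

/-- `S` is `K`-satisfiable with constant `c`: for a spectral decomposition `A = U D Uᵀ` with
nonincreasing eigenvalues, and the columns of `U` split into `U₁` (eigenvalues greater than `λ`)
and `U₂` (the other ones), `‖(S U₁)ᵀ S U₁ - I‖ ≤ 1/2` and `‖S U₂ D₂^{1/2}‖ ≤ c λ^{1/2}` in operator
norm. Neither norm depends on the choice of `U`. -/
def IsKSatisfiable {n s : ℕ} (c lam : ℝ) (A : Matrix (Fin n) (Fin n) ℝ)
    (S : Matrix (Fin s) (Fin n) ℝ) : Prop :=
  ∃ U ∈ Matrix.orthogonalGroup (Fin n) ℝ, ∃ ev : Fin n → ℝ, Antitone ev ∧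
    A = U * Matrix.diagonal ev * Uᵀ ∧
    (let U₁ : Matrix (Fin n) {j // lam < ev j} ℝ := U.submatrix id Subtype.val
     opNorm ((S * U₁)ᵀ * (S * U₁) - 1) ≤ 1 / 2) ∧
    (let U₂ : Matrix (Fin n) {j // ev j ≤ lam} ℝ := U.submatrix id Subtype.val
     opNorm (S * U₂ * Matrix.diagonal (fun j => √(ev j.1))) ≤ c * √lam)

/-- `exp(-a)` for `a ∈ [0, ∞]`, with `exp(-∞) = 0`. -/
def expNeg (a : ℝ≥0∞) : ℝ := if a = ∞ then 0 else Real.exp (-a.toReal)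

/-- The event `E` is of `(a, b)`-type given `X`:
`P(P(E | X) ≥ 1 - exp(-a)) ≥ 1 - exp(-b)`. -/
def IsOfType {Ω 𝒵 : Type*} [MeasurableSpace Ω] [MeasurableSpace 𝒵] (P : Measure Ω)
    (X : Ω → 𝒵) (a b : ℝ≥0∞) (E : Set Ω) : Prop :=
  1 - expNeg b ≤ P.real {ω | 1 - expNeg a ≤
    (P[E.indicator (fun _ => (1 : ℝ)) | MeasurableSpace.comap X inferInstance]) ω}

end SketchedKRR

end

noncomputable section

/-! ### Moments of the standard normal distribution -/

/-! Write `Q = I - H`, `Δ` for the smoothing matrix and `R = QΔ²Q`. Under the null hypothesis `Q`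
annihilates the values of `f` at the design points, so on the well-posed event `nT = εᵀRε`
(`linStat_eq_noise`). Given `(x, S)` the matrix `R` is fixed and `ε` is still standard normal, so
rotating to an eigenbasis of `R` turns `εᵀRε - tr R` into `∑ ρᵢ(Zᵢ² - 1)`
(`map_quadForm_sub_trace_gaussianPi`). This yields the exact conditional mean and variance. As `0 ≤
ρᵢ ≤ 1`, it also yields a central limit theorem once `tr R² = ∑ ρᵢ²` diverges in probability: after
normalization every single weight is negligible, and characteristic functions are compared with
Gaussian ones factor by factor (`exists_norm_charFun_normalized_quadForm_le`). The conditioning is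
removed in `tendstoInDistribution_gaussianReal_of_conditional_charFun`.

The two normalizations use `tr QΔ⁴Q` and `tr R²`. Since `H` has rank `d + 1` and `Δ ≤ I`, these
differ by at most `d + 1`, and both are at least `tr Δ⁴` up to a constant (`trace_comparison`).
Everything thus reduces to the divergence of `tr Δ⁴` in probability
(`tendsto_measure_not_le_trace`).

No rate is needed for that, so a number `k` can be fixed. By the law of large numbers the first `k`
eigenfunctions are nearly orthonormal on the sample, and truncating the Mercer series gives at least
`k` empirical eigenvalues above `λ` once `λ < ev k / 2` (`le_card_eigenvalues`). On the
satisfiability event each corresponding unit eigenvector `u` has `uᵀΔu ≥ 1/(2 + 4c²)`, by a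
variational bound with an explicit trial vector (`smoother_diagonal_apply_ge`), so `tr Δ⁴ ≥ k(2 +
4c²)⁻⁴`. That event has probability tending to one because both `s` and `s_λ` diverge
(`tendsto_measure_compl_of_isOfType`). -/

theorem iteratedDeriv_two_exp_sq_div_two :
    iteratedDeriv 2 (fun t : ℝ => Real.exp (t ^ 2 / 2)) =
      fun t => (1 + t ^ 2) * Real.exp (t ^ 2 / 2) := by
  have hE : ∀ t : ℝ, HasDerivAt (fun t : ℝ => Real.exp (t ^ 2 / 2)) (Real.exp (t ^ 2 / 2) * t) t := by
    intro t
    have h := (((hasDerivAt_pow 2 t).div_const 2).exp)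
    convert! h using 1
    simp
  have h1 : deriv (fun t : ℝ => Real.exp (t ^ 2 / 2)) = fun t => Real.exp (t ^ 2 / 2) * t :=
    funext fun t => (hE t).deriv
  rw [iteratedDeriv_succ, iteratedDeriv_one, h1]
  funext t
  rw [((hE t).fun_mul (hasDerivAt_id' t)).deriv]
  ring

theorem iteratedDeriv_four_exp_sq_div_two :
    iteratedDeriv 4 (fun t : ℝ => Real.exp (t ^ 2 / 2)) =
      fun t => (3 + 6 * t ^ 2 + t ^ 4) * Real.exp (t ^ 2 / 2) := by
  have hE : ∀ t : ℝ, HasDerivAt (fun t : ℝ => Real.exp (t ^ 2 / 2)) (Real.exp (t ^ 2 / 2) * t) t := by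
    intro t
    have h := (((hasDerivAt_pow 2 t).div_const 2).exp)
    convert! h using 1
    simp
  have h3 : deriv (fun t : ℝ => (1 + t ^ 2) * Real.exp (t ^ 2 / 2)) =
      fun t => (3 * t + t ^ 3) * Real.exp (t ^ 2 / 2) := by
    funext t
    rw [(((hasDerivAt_pow 2 t).const_add 1).fun_mul (hE t)).deriv]
    simp
    ring
  have h4 : deriv (fun t : ℝ => (3 * t + t ^ 3) * Real.exp (t ^ 2 / 2)) =
      fun t => (3 + 6 * t ^ 2 + t ^ 4) * Real.exp (t ^ 2 / 2) := by
    funext t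
    rw [((((hasDerivAt_id' t).const_mul 3).fun_add (hasDerivAt_pow 3 t)).fun_mul (hE t)).deriv]
    simp
    ring
  rw [iteratedDeriv_succ, iteratedDeriv_succ, iteratedDeriv_two_exp_sq_div_two, h3, h4]

/-- Moments are derivatives at `0` of the moment generating function `exp(t²/2)`. -/
theorem integral_sq_gaussianReal : ∫ z, z ^ 2 ∂gaussianReal 0 1 = 1 := by
  have h := iteratedDeriv_mgf_zero (X := fun x : ℝ => x) (μ := gaussianReal 0 1) (by simp) 2
  simp only [Pi.pow_apply, mgf_fun_id_gaussianReal, NNReal.coe_one, zero_mul, zero_add, one_mul,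
    iteratedDeriv_two_exp_sq_div_two] at h
  rw [← h]; simp

theorem integral_pow_four_gaussianReal : ∫ z, z ^ 4 ∂gaussianReal 0 1 = 3 := by
  have h := iteratedDeriv_mgf_zero (X := fun x : ℝ => x) (μ := gaussianReal 0 1) (by simp) 4
  simp only [Pi.pow_apply, mgf_fun_id_gaussianReal, NNReal.coe_one, zero_mul, zero_add, one_mul,
    iteratedDeriv_four_exp_sq_div_two] at h
  rw [← h]; simp

theorem integrable_pow_gaussianReal (k : ℕ) : Integrable (fun z : ℝ => z ^ k) (gaussianReal 0 1) :=
  integrable_pow_of_mem_interior_integrableExpSet (X := fun z : ℝ => z) (by simp) k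

theorem integral_sq_sub_one_gaussianReal : ∫ z, (z ^ 2 - 1) ∂gaussianReal 0 1 = 0 := by
  rw [integral_sub (integrable_pow_gaussianReal 2) (integrable_const _), integral_sq_gaussianReal]
  simp

theorem integral_sq_sub_one_sq_gaussianReal : ∫ z, (z ^ 2 - 1) ^ 2 ∂gaussianReal 0 1 = 2 := by
  have h : ∀ z : ℝ, (z ^ 2 - 1) ^ 2 = z ^ 4 - 2 * z ^ 2 + 1 := fun z => by ring
  simp_rw [h]
  rw [integral_add (f := fun z : ℝ => z ^ 4 - 2 * z ^ 2)
    ((integrable_pow_gaussianReal 4).sub ((integrable_pow_gaussianReal 2).const_mul 2))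
    (integrable_const _), integral_sub (integrable_pow_gaussianReal 4)
    ((integrable_pow_gaussianReal 2).const_mul 2), integral_const_mul, integral_sq_gaussianReal,
    integral_pow_four_gaussianReal]
  norm_num

theorem memLp_sq_sub_one_gaussianReal : MemLp (fun z : ℝ => z ^ 2 - 1) 2 (gaussianReal 0 1) := by
  refine (memLp_two_iff_integrable_sq (by fun_prop)).2 (.of_integral_ne_zero ?_)
  rw [integral_sq_sub_one_sq_gaussianReal]; norm_num

/-- The characteristic function of `Z² - 1`, for `Z` standard normal, is `1 - w² + o(w²)`. -/
theorem charFun_sq_sub_one_isLittleO :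
    (fun w : ℝ => charFun ((gaussianReal 0 1).map fun z => z ^ 2 - 1) w - (1 - (w : ℂ) ^ 2))
      =o[𝓝 0] fun w => w ^ 2 := by
  -- `Z² - 1` has variance `2`; after division by `√2` the second-order Taylor expansion `1 - t²/2`
  -- applies, and `t = √2 w` turns it into `1 - w²`.
  set X : ℝ → ℝ := fun z => (√2)⁻¹ * (z ^ 2 - 1) with hX
  have h0 : (gaussianReal 0 1)[X] = 0 := by
    rw [hX, integral_const_mul, integral_sq_sub_one_gaussianReal, mul_zero]
  have h1 : (gaussianReal 0 1)[X ^ 2] = 1 := by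
    simp only [hX, Pi.pow_apply, mul_pow, inv_pow, Real.sq_sqrt zero_le_two]
    rw [integral_const_mul, integral_sq_sub_one_sq_gaussianReal]; norm_num
  have h := taylor_charFun_two (by fun_prop) h0 h1
  have hlim : Tendsto (fun w : ℝ => √2 * w) (𝓝 0) (𝓝 0) := by
    have : Continuous fun w : ℝ => √2 * w := by fun_prop
    simpa using this.tendsto 0
  have h2 := h.comp_tendsto hlim
  have hs : ((√2 : ℝ) : ℂ) ^ 2 = 2 := by
    rw [← Complex.ofReal_pow, Real.sq_sqrt zero_le_two]; simp
  refine (h2.congr_left fun w => ?_).trans_isBigO ?_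
  · simp only [Function.comp_apply]
    congr 1
    · rw [hX, charFun_map_mul_comp (by fun_prop)]
      congr 1
      field_simp
    · push_cast
      rw [mul_pow, hs]; ring
  · have : ((fun t : ℝ => t ^ 2) ∘ fun w : ℝ => √2 * w) = fun w => 2 * w ^ 2 := by
      funext w; simp [mul_pow]
    rw [this]
    exact (Asymptotics.isBigO_refl _ _).const_mul_left 2

/-- A uniform second-order comparison of the characteristic functions of `w (Z² - 1)` and
of a centered normal variable with the same variance. -/
theorem exists_norm_charFun_sq_sub_one_sub_exp_le {r : ℝ} (hr : 0 < r) :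
    ∃ δ > 0, ∀ w : ℝ, |w| ≤ δ →
      ‖charFun ((gaussianReal 0 1).map fun z => z ^ 2 - 1) w - Complex.exp (-(w : ℂ) ^ 2)‖
        ≤ r * w ^ 2 := by
  have h := charFun_sq_sub_one_isLittleO.def (half_pos hr)
  rw [Metric.eventually_nhds_iff] at h
  obtain ⟨δ, hδ, h⟩ := h
  -- `δ / 2` makes the bound strict, `1` permits the quadratic remainder bound for `exp`, and `√(r /
  -- 2)` absorbs the resulting `w⁴` into `(r / 2) w²`.
  refine ⟨min (δ / 2) (min 1 (√(r / 2))), by positivity, fun w hw => ?_⟩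
  have hw1 : |w| ≤ 1 := hw.trans ((min_le_right _ _).trans (min_le_left _ _))
  have hw2 : w ^ 2 ≤ r / 2 := by
    rw [← sq_abs, ← Real.sq_sqrt (half_pos hr).le]
    exact pow_le_pow_left₀ (abs_nonneg w) (hw.trans ((min_le_right _ _).trans (min_le_right _ _))) 2
  have hwδ : |w| ≤ δ / 2 := hw.trans (min_le_left _ _)
  have h1 := h (y := w) (by rw [Real.dist_eq, sub_zero]; linarith)
  rw [Real.norm_of_nonneg (sq_nonneg w)] at h1
  have hsq : w ^ 2 ≤ 1 := by rw [← sq_abs]; exact pow_le_one₀ (abs_nonneg w) hw1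
  have h2 : ‖Complex.exp (-(w : ℂ) ^ 2) - 1 - (-(w : ℂ) ^ 2)‖ ≤ r / 2 * w ^ 2 := by
    have hn : ‖-(w : ℂ) ^ 2‖ = w ^ 2 := by simp
    have := Complex.norm_exp_sub_one_sub_id_le (x := -(w : ℂ) ^ 2) (by rw [hn]; exact hsq)
    rw [hn] at this
    nlinarith [sq_nonneg w]
  calc _ = ‖(charFun ((gaussianReal 0 1).map fun z => z ^ 2 - 1) w - (1 - (w : ℂ) ^ 2))
        - (Complex.exp (-(w : ℂ) ^ 2) - 1 - (-(w : ℂ) ^ 2))‖ := by congr 1; ring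
    _ ≤ _ := norm_sub_le _ _
    _ ≤ r * w ^ 2 := by linarith

/-- Products of complex numbers of norm at most one are compared factor by factor. -/
theorem norm_prod_sub_prod_le_sum {ι : Type*} (t : Finset ι) (a b : ι → ℂ)
    (ha : ∀ i, ‖a i‖ ≤ 1) (hb : ∀ i, ‖b i‖ ≤ 1) :
    ‖∏ i ∈ t, a i - ∏ i ∈ t, b i‖ ≤ ∑ i ∈ t, ‖a i - b i‖ := by
  classical
  induction t using Finset.induction_on with
  | empty => simp
  | insert j t hj ih =>
    rw [Finset.prod_insert hj, Finset.prod_insert hj, Finset.sum_insert hj]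
    have hP : ‖∏ i ∈ t, a i‖ ≤ 1 := by
      rw [norm_prod]; exact Finset.prod_le_one (fun _ _ => norm_nonneg _) fun i _ => ha i
    calc _ = ‖(a j - b j) * ∏ i ∈ t, a i + b j * (∏ i ∈ t, a i - ∏ i ∈ t, b i)‖ := by
          congr 1; ring
      _ ≤ ‖a j - b j‖ * ‖∏ i ∈ t, a i‖ + ‖b j‖ * ‖∏ i ∈ t, a i - ∏ i ∈ t, b i‖ := by
          rw [← norm_mul, ← norm_mul]; exact norm_add_le _ _
      _ ≤ ‖a j - b j‖ * 1 + 1 * ‖∏ i ∈ t, a i - ∏ i ∈ t, b i‖ := by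
          gcongr; exact hb j
      _ ≤ _ := by linarith

/-! ### Quadratic forms of a standard normal vector -/

section QuadraticForm

variable {ι : Type*} [Fintype ι]

/-- The law of a vector of independent standard normal variables. -/
abbrev gaussianPi (ι : Type*) [Fintype ι] : Measure (ι → ℝ) :=
  Measure.pi fun _ => gaussianReal 0 1

theorem measurable_quadForm (A : Matrix ι ι ℝ) : Measurable fun e : ι → ℝ => e ⬝ᵥ A *ᵥ e := by
  simp only [Matrix.mulVec, dotProduct]; fun_prop

theorem measurable_sum_mul_sq_sub_one (a : ι → ℝ) :
    Measurable fun z : ι → ℝ => ∑ i, a i * (z i ^ 2 - 1) :=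
  Finset.measurable_sum _ fun i _ => by fun_prop

theorem memLp_sum_mul_sq_sub_one (a : ι → ℝ) :
    MemLp (fun z : ι → ℝ => ∑ i, a i * (z i ^ 2 - 1)) 2 (gaussianPi ι) := by
  refine memLp_finsetSum _ fun i _ => MemLp.const_mul ?_ _
  exact memLp_sq_sub_one_gaussianReal.comp_measurePreserving
    (measurePreserving_eval (fun _ : ι => gaussianReal 0 1) i)

theorem integral_sum_mul_sq_sub_one (a : ι → ℝ) :
    ∫ z, ∑ i, a i * (z i ^ 2 - 1) ∂gaussianPi ι = 0 := by
  rw [integral_finsetSum]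
  · refine Finset.sum_eq_zero fun i _ => ?_
    rw [integral_const_mul]
    have h := integral_comp_eval (μ := fun _ : ι => gaussianReal 0 1) (i := i)
      (f := fun z : ℝ => z ^ 2 - 1) (by fun_prop)
    rw [h, integral_sq_sub_one_gaussianReal, mul_zero]
  · intro i _
    have h := memLp_sq_sub_one_gaussianReal.comp_measurePreserving
      (measurePreserving_eval (fun _ : ι => gaussianReal 0 1) i)
    exact (h.integrable one_le_two).const_mul _

theorem integral_sum_mul_sq_sub_one_sq (a : ι → ℝ) :
    ∫ z, (∑ i, a i * (z i ^ 2 - 1)) ^ 2 ∂gaussianPi ι = 2 * ∑ i, a i ^ 2 := by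
  have h := variance_sum_pi (μ := fun _ : ι => gaussianReal 0 1)
    (X := fun i z => a i * (z ^ 2 - 1)) fun i => memLp_sq_sub_one_gaussianReal.const_mul _
  have h1 : ∀ i, Var[fun z : ℝ => a i * (z ^ 2 - 1); gaussianReal 0 1] = 2 * a i ^ 2 := by
    intro i
    rw [variance_const_mul, variance_of_integral_eq_zero (by fun_prop) integral_sq_sub_one_gaussianReal]
    rw [integral_sq_sub_one_sq_gaussianReal]; ring
  rw [Finset.mul_sum, ← Finset.sum_congr rfl fun i _ => h1 i, ← h]
  have h2 : (∑ i, fun ω : ι → ℝ => a i * (ω i ^ 2 - 1)) = fun ω => ∑ i, a i * (ω i ^ 2 - 1) := by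
    funext ω; simp
  rw [h2, variance_of_integral_eq_zero (measurable_sum_mul_sq_sub_one a).aemeasurable
    (integral_sum_mul_sq_sub_one a)]

variable [DecidableEq ι] {A : Matrix ι ι ℝ}

theorem dotProduct_mulVec_sum_eigenvectorBasis (hA : A.IsHermitian) (z : ι → ℝ) :
    WithLp.ofLp (∑ i, z i • hA.eigenvectorBasis i) ⬝ᵥ
      A *ᵥ WithLp.ofLp (∑ i, z i • hA.eigenvectorBasis i) = ∑ i, hA.eigenvalues i * z i ^ 2 := by
  have h1 : A *ᵥ WithLp.ofLp (∑ i, z i • hA.eigenvectorBasis i)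
      = WithLp.ofLp (∑ i, (hA.eigenvalues i * z i) • hA.eigenvectorBasis i) := by
    simp only [WithLp.ofLp_sum, WithLp.ofLp_smul, Matrix.mulVec_sum, Matrix.mulVec_smul,
      hA.mulVec_eigenvectorBasis, smul_smul, mul_comm]
  have h2 : ∀ u v : EuclideanSpace ℝ ι, WithLp.ofLp u ⬝ᵥ WithLp.ofLp v = inner ℝ v u := by
    intro u v; simp [PiLp.inner_apply, dotProduct]
  rw [h1, h2, hA.eigenvectorBasis.orthonormal.inner_sum]
  exact Finset.sum_congr rfl fun i _ => by simp; ring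

/-- A quadratic form of a standard normal vector has the law of a weighted sum of squares. -/
theorem map_quadForm_gaussianPi (hA : A.IsHermitian) :
    (gaussianPi ι).map (fun e => e ⬝ᵥ A *ᵥ e)
      = (gaussianPi ι).map fun z => ∑ i, hA.eigenvalues i * z i ^ 2 := by
  -- Rotation invariance: independent standard normal coordinates in the eigenbasis give the same
  -- law as in the standard basis.
  have h := (map_pi_eq_stdGaussian (ι := ι)).trans
    (stdGaussian_eq_map_pi_orthonormalBasis hA.eigenvectorBasis)
  have hq : Measurable fun v : EuclideanSpace ℝ ι => WithLp.ofLp v ⬝ᵥ A *ᵥ WithLp.ofLp v := by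
    simp only [Matrix.mulVec, dotProduct]; fun_prop
  have h' := congrArg (Measure.map fun v : EuclideanSpace ℝ ι => WithLp.ofLp v ⬝ᵥ A *ᵥ WithLp.ofLp v) h
  rw [Measure.map_map hq (by fun_prop), Measure.map_map hq (by fun_prop)] at h'
  convert! h' using 2
  funext z
  exact (dotProduct_mulVec_sum_eigenvectorBasis hA z).symm

theorem Matrix.IsHermitian.trace_sq_eq_sum_eigenvalues_sq (hA : A.IsHermitian) :
    (A ^ 2).trace = ∑ i, hA.eigenvalues i ^ 2 := by
  set U := hA.eigenvectorUnitary
  have hs := hA.spectral_theorem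
  have h2 : A ^ 2 = Unitary.conjStarAlgAut ℝ _ U
      (Matrix.diagonal (RCLike.ofReal ∘ hA.eigenvalues) ^ 2) := by
    rw [map_pow, ← hs]
  rw [h2, Unitary.conjStarAlgAut_apply, Matrix.trace_mul_comm, ← mul_assoc]
  simp [pow_two, Matrix.diagonal_mul_diagonal]

theorem Matrix.IsHermitian.trace_eq_sum_eigenvalues_real (hA : A.IsHermitian) :
    A.trace = ∑ i, hA.eigenvalues i := by
  simpa using hA.trace_eq_sum_eigenvalues

theorem map_quadForm_sub_trace_gaussianPi (hA : A.IsHermitian) :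
    (gaussianPi ι).map (fun e => e ⬝ᵥ A *ᵥ e - A.trace)
      = (gaussianPi ι).map fun z => ∑ i, hA.eigenvalues i * (z i ^ 2 - 1) := by
  have h := congrArg (Measure.map fun x : ℝ => x - A.trace) (map_quadForm_gaussianPi hA)
  rw [Measure.map_map (by fun_prop) (measurable_quadForm A),
    Measure.map_map (by fun_prop) (by fun_prop)] at h
  refine h.trans ?_
  congr 1
  funext z
  simp only [Function.comp_apply, hA.trace_eq_sum_eigenvalues_real, mul_sub, mul_one,
    Finset.sum_sub_distrib]

theorem integral_comp_quadForm_sub_trace {E : Type*} [NormedAddCommGroup E] [NormedSpace ℝ E]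
    (hA : A.IsHermitian) (F : ℝ → E) (hF : StronglyMeasurable F) :
    ∫ e, F (e ⬝ᵥ A *ᵥ e - A.trace) ∂gaussianPi ι
      = ∫ z, F (∑ i, hA.eigenvalues i * (z i ^ 2 - 1)) ∂gaussianPi ι := by
  have hm : Measurable fun e : ι → ℝ => e ⬝ᵥ A *ᵥ e - A.trace := (measurable_quadForm A).sub_const _
  rw [← integral_map (f := F) hm.aemeasurable hF.aestronglyMeasurable,
    map_quadForm_sub_trace_gaussianPi hA,
    integral_map (measurable_sum_mul_sq_sub_one _).aemeasurable hF.aestronglyMeasurable]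

theorem integrable_quadForm_gaussianPi (hA : A.IsHermitian) :
    Integrable (fun e : ι → ℝ => e ⬝ᵥ A *ᵥ e) (gaussianPi ι) := by
  have hm : Measurable fun e : ι → ℝ => e ⬝ᵥ A *ᵥ e - A.trace := (measurable_quadForm A).sub_const _
  have h : Integrable (fun e : ι → ℝ => e ⬝ᵥ A *ᵥ e - A.trace) (gaussianPi ι) := by
    have h1 : Integrable (fun x : ℝ => x)
        ((gaussianPi ι).map fun z => ∑ i, hA.eigenvalues i * (z i ^ 2 - 1)) := by
      rw [integrable_map_measure (by fun_prop) (measurable_sum_mul_sq_sub_one _).aemeasurable]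
      exact (memLp_sum_mul_sq_sub_one _).integrable one_le_two
    rw [← map_quadForm_sub_trace_gaussianPi hA,
      integrable_map_measure (by fun_prop) hm.aemeasurable] at h1
    exact h1
  exact (h.add (integrable_const A.trace)).congr (.of_forall fun e => by simp)

/-- The mean of a quadratic form of a standard normal vector. -/
theorem integral_quadForm_gaussianPi (hA : A.IsHermitian) :
    ∫ e, e ⬝ᵥ A *ᵥ e ∂gaussianPi ι = A.trace := by
  have h := integral_comp_quadForm_sub_trace hA (fun x => x) stronglyMeasurable_id
  rw [integral_sum_mul_sq_sub_one, integral_sub (integrable_quadForm_gaussianPi hA)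
    (integrable_const _)] at h
  simp at h
  linarith

/-- The variance of a quadratic form of a standard normal vector. -/
theorem integral_quadForm_sub_trace_sq_gaussianPi (hA : A.IsHermitian) :
    ∫ e, (e ⬝ᵥ A *ᵥ e - A.trace) ^ 2 ∂gaussianPi ι = 2 * (A ^ 2).trace := by
  rw [integral_comp_quadForm_sub_trace hA (fun x => x ^ 2) (by fun_prop),
    integral_sum_mul_sq_sub_one_sq, hA.trace_sq_eq_sum_eigenvalues_sq]

/-- In eigencoordinates the exponent is a sum of functions of single independent coordinates, so the
integral factorizes. -/
theorem integral_exp_quadForm_sub_trace (hA : A.IsHermitian) (t : ℝ) :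
    ∫ e, Complex.exp (t * ((e ⬝ᵥ A *ᵥ e - A.trace : ℝ) : ℂ) * Complex.I) ∂gaussianPi ι
      = ∏ i, charFun ((gaussianReal 0 1).map fun z => z ^ 2 - 1) (t * hA.eigenvalues i) := by
  rw [integral_comp_quadForm_sub_trace hA (fun x : ℝ => Complex.exp (t * (x : ℂ) * Complex.I))
    (by fun_prop)]
  have h : ∀ z : ι → ℝ, Complex.exp (t * ((∑ i, hA.eigenvalues i * (z i ^ 2 - 1) : ℝ) : ℂ)
      * Complex.I) = ∏ i, Complex.exp ((t * hA.eigenvalues i : ℝ) * ((z i ^ 2 - 1 : ℝ) : ℂ)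
      * Complex.I) := by
    intro z
    rw [← Complex.exp_sum]
    congr 1
    push_cast
    rw [Finset.mul_sum, Finset.sum_mul]
    exact Finset.sum_congr rfl fun i _ => by ring
  simp_rw [h]
  rw [integral_fintype_prod_eq_prod (μ := fun _ : ι => gaussianReal 0 1) (f := fun i x =>
    Complex.exp ((t * hA.eigenvalues i : ℝ) * ((x ^ 2 - 1 : ℝ) : ℂ) * Complex.I))]
  refine Finset.prod_congr rfl fun i _ => ?_
  rw [charFun_apply_real, integral_map (by fun_prop) (by fun_prop)]

/-- The characteristic function of a centered quadratic form of a standard normal vector is close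
to that of a normal variable with the same variance when no eigenvalue is large. -/
theorem exists_norm_integral_exp_quadForm_sub_exp_le {r : ℝ} (hr : 0 < r) :
    ∃ δ > 0, ∀ {ι : Type} [Fintype ι] [DecidableEq ι] {A : Matrix ι ι ℝ} (hA : A.IsHermitian)
      (t : ℝ), (∀ i, |t * hA.eigenvalues i| ≤ δ) →
      ‖∫ e, Complex.exp (t * ((e ⬝ᵥ A *ᵥ e - A.trace : ℝ) : ℂ) * Complex.I) ∂gaussianPi ι
        - Complex.exp ((-(t ^ 2 * (A ^ 2).trace) : ℝ) : ℂ)‖ ≤ r * (t ^ 2 * (A ^ 2).trace) := by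
  obtain ⟨δ, hδ, h⟩ := exists_norm_charFun_sq_sub_one_sub_exp_le hr
  -- The threshold depends on `r` alone, so it serves all dimensions; the factorwise errors `r (t
  -- ρᵢ)²` add up to `r t² tr A²`.
  refine ⟨δ, hδ, fun {ι} _ _ {A} hA t ht => ?_⟩
  have hp : IsProbabilityMeasure ((gaussianReal 0 1).map fun z : ℝ => z ^ 2 - 1) :=
    Measure.isProbabilityMeasure_map (by fun_prop)
  rw [integral_exp_quadForm_sub_trace hA, hA.trace_sq_eq_sum_eigenvalues_sq]
  have he : Complex.exp ((-(t ^ 2 * ∑ i, hA.eigenvalues i ^ 2) : ℝ) : ℂ)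
      = ∏ i, Complex.exp (-((t * hA.eigenvalues i : ℝ) : ℂ) ^ 2) := by
    rw [← Complex.exp_sum]
    congr 1
    push_cast
    rw [Finset.mul_sum, ← Finset.sum_neg_distrib]
    exact Finset.sum_congr rfl fun i _ => by ring
  rw [he]
  refine (norm_prod_sub_prod_le_sum _ _ _ (fun i => norm_charFun_le_one _) fun i => ?_).trans ?_
  · rw [← Complex.ofReal_pow, ← Complex.ofReal_neg, Complex.norm_exp_ofReal]
    exact Real.exp_le_one_iff.2 (by nlinarith [sq_nonneg (t * hA.eigenvalues i)])
  · rw [Finset.mul_sum, Finset.mul_sum]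
    refine Finset.sum_le_sum fun i _ => (h _ (ht i)).trans_eq ?_
    ring

end QuadraticForm

/-! ### Real positive semidefinite matrices -/

section PosSemidef

theorem Matrix.PosSemidef.transpose_eq {n : Type*} {A : Matrix n n ℝ} (hA : A.PosSemidef) :
    Aᵀ = A := by
  simpa using hA.isHermitian.eq

variable {m n : Type*} [Fintype m] [Fintype n]

theorem Matrix.PosSemidef.conj_transpose {A : Matrix n n ℝ} (hA : A.PosSemidef)
    (B : Matrix m n ℝ) : (B * A * Bᵀ).PosSemidef := by
  simpa using hA.mul_mul_conjTranspose_same B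

theorem Matrix.PosSemidef.conj_symm {A B : Matrix n n ℝ} (hA : A.PosSemidef) (hB : Bᵀ = B) :
    (B * A * B).PosSemidef := by
  simpa [hB] using hA.conj_transpose B

theorem Matrix.posSemidef_of_isSymm_of_isIdempotentElem {B : Matrix n n ℝ} (hB : Bᵀ = B)
    (hi : B * B = B) : B.PosSemidef := by
  have := Matrix.posSemidef_conjTranspose_mul_self B
  simpa [hB, hi] using this

variable [DecidableEq n]

/-- `1 - A = (1 - A)² + (A - A²)`. -/
theorem Matrix.one_sub_posSemidef_of_sub_sq {A : Matrix n n ℝ} (hA : Aᵀ = A)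
    (h : (A - A * A).PosSemidef) : (1 - A).PosSemidef := by
  have h1 : ((1 - A) * 1 * (1 - A)).PosSemidef :=
    Matrix.PosSemidef.one.conj_symm (by rw [Matrix.transpose_sub, Matrix.transpose_one, hA])
  have := h1.add h
  convert! this using 1
  noncomm_ring

theorem Matrix.IsHermitian.eigenvalues_le_one {A : Matrix n n ℝ} (hA : A.IsHermitian)
    (h : (1 - A).PosSemidef) (i : n) : hA.eigenvalues i ≤ 1 := by
  have h1 := h.dotProduct_mulVec_nonneg (hA.eigenvectorBasis i)
  have h2 : WithLp.ofLp (hA.eigenvectorBasis i) ⬝ᵥ WithLp.ofLp (hA.eigenvectorBasis i) = 1 := by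
    have := hA.eigenvectorBasis.orthonormal.1 i
    have h3 := EuclideanSpace.real_norm_sq_eq (hA.eigenvectorBasis i)
    rw [this] at h3
    simp only [dotProduct, ← pow_two, ← h3]; norm_num
  rw [Matrix.sub_mulVec, Matrix.one_mulVec, hA.mulVec_eigenvectorBasis, star_trivial,
    dotProduct_sub, dotProduct_smul, h2] at h1
  simpa using h1

end PosSemidef

namespace SketchedKRR

/-! ### The smoothing matrix -/

section Smoother

variable {n s : ℕ} {A : Matrix (Fin n) (Fin n) ℝ} {S : Matrix (Fin s) (Fin n) ℝ} {lam : ℝ}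

theorem gramMatrix_posSemidef (hA : A.PosSemidef) (hlam : 0 < lam) :
    (gramMatrix A S lam).PosSemidef :=
  ((hA.pow 2).conj_transpose S).add ((hA.conj_transpose S).smul hlam.le)

theorem smoother_eq (hA : A.PosSemidef) :
    smoother A S lam = (A * Sᵀ) * (gramMatrix A S lam)⁻¹ * (A * Sᵀ)ᵀ := by
  rw [smoother, Matrix.transpose_mul, Matrix.transpose_transpose, hA.transpose_eq]
  simp only [Matrix.mul_assoc]

theorem smoother_posSemidef (hA : A.PosSemidef) (hlam : 0 < lam) :
    (smoother A S lam).PosSemidef := by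
  rw [smoother_eq hA]
  exact (gramMatrix_posSemidef hA hlam).inv.conj_transpose _

/-- With `M` the Gram matrix, `Δ = (ASᵀM⁻¹) M (M⁻¹SA)`, while `Δ²` has `SA²Sᵀ` in place of the
middle `M`. The difference of the middle factors is `λSASᵀ`, so `Δ - Δ²` is a congruence of `λA`.
This makes `Δ` a contraction. -/
theorem smoother_sub_sq_posSemidef (hA : A.PosSemidef) (hlam : 0 < lam)
    (hM : IsUnit (gramMatrix A S lam).det) :
    (smoother A S lam - smoother A S lam * smoother A S lam).PosSemidef := by
  set M := gramMatrix A S lam with hMdef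
  have hMi : (M⁻¹)ᵀ = M⁻¹ := (gramMatrix_posSemidef hA hlam).inv.transpose_eq
  have h := ((hA.conj_transpose (A * Sᵀ * M⁻¹ * S))).smul hlam.le
  have h1 : smoother A S lam = (A * Sᵀ * M⁻¹) * M * (M⁻¹ * S * A) := by
    rw [Matrix.mul_assoc (A * Sᵀ) M⁻¹ M, Matrix.nonsing_inv_mul _ hM, Matrix.mul_one, smoother]
    simp only [← hMdef, Matrix.mul_assoc]
  convert! h using 1
  have h2 : smoother A S lam * smoother A S lam
      = (A * Sᵀ * M⁻¹) * (S * A ^ 2 * Sᵀ) * (M⁻¹ * S * A) := by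
    rw [smoother, ← hMdef]
    simp only [Matrix.mul_assoc, pow_two]
  have h3 : M - S * A ^ 2 * Sᵀ = lam • (S * A * Sᵀ) := by rw [hMdef, gramMatrix]; abel
  rw [h2, h1, ← Matrix.sub_mul, ← Matrix.mul_sub, h3]
  simp only [Matrix.transpose_mul, hMi, hA.transpose_eq, Matrix.transpose_transpose,
    Matrix.mul_smul, Matrix.smul_mul, Matrix.mul_assoc]

/-- Dual variational principle: `vᵀΔv` is the maximum over `b` of `2 bᵀSAv - bᵀMb`, so every trial
vector gives a lower bound. -/
theorem le_smoother_quadForm (hA : A.PosSemidef) (hlam : 0 < lam)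
    (hM : IsUnit (gramMatrix A S lam).det) (v : Fin n → ℝ) (b : Fin s → ℝ) {C : ℝ} (hC : 0 < C)
    (hb : b ⬝ᵥ (S * A) *ᵥ v = 1) (hbM : b ⬝ᵥ gramMatrix A S lam *ᵥ b ≤ C) :
    1 / C ≤ v ⬝ᵥ smoother A S lam *ᵥ v := by
  set M := gramMatrix A S lam with hMdef
  have hMpsd : M.PosSemidef := gramMatrix_posSemidef hA hlam
  set g := M⁻¹ *ᵥ ((S * A) *ᵥ v) with hg
  have hMg : M *ᵥ g = (S * A) *ᵥ v := by
    rw [hg, Matrix.mulVec_mulVec, Matrix.mul_nonsing_inv _ hM, Matrix.one_mulVec]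
  have hv : v ⬝ᵥ smoother A S lam *ᵥ v = g ⬝ᵥ M *ᵥ g := by
    have : smoother A S lam = (S * A)ᵀ * (M⁻¹ * (S * A)) := by
      rw [smoother, Matrix.transpose_mul, hA.transpose_eq]
      simp only [← hMdef, Matrix.mul_assoc]
    rw [this, ← Matrix.mulVec_mulVec, Matrix.dotProduct_mulVec v, Matrix.vecMul_transpose, hMg,
      dotProduct_comm, ← Matrix.mulVec_mulVec]
  have hsymm : g ⬝ᵥ M *ᵥ b = b ⬝ᵥ M *ᵥ g := by
    rw [Matrix.dotProduct_mulVec, ← Matrix.mulVec_transpose, hMpsd.transpose_eq, dotProduct_comm]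
  -- Scaling the trial vector by `C⁻¹` gives `2/C - C⁻² bᵀMb ≥ 1/C`; `g` is the maximizer.
  have hpos := hMpsd.dotProduct_mulVec_nonneg (C⁻¹ • b - g)
  simp only [star_trivial, Matrix.mulVec_sub, dotProduct_sub, sub_dotProduct, Matrix.mulVec_smul,
    smul_dotProduct, dotProduct_smul, smul_eq_mul, hsymm] at hpos
  rw [hMg, hb] at hpos
  rw [hv]
  have h1 : C⁻¹ * (C⁻¹ * (b ⬝ᵥ M *ᵥ b)) ≤ C⁻¹ := by
    calc _ ≤ C⁻¹ * (C⁻¹ * C) := by gcongr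
      _ = C⁻¹ := by field_simp
  rw [hMg] at *
  rw [one_div]
  linarith

/-- The smoothing matrix is equivariant under rotations. -/
theorem transpose_mul_smoother_mul {U : Matrix (Fin n) (Fin n) ℝ}
    (hU : U ∈ Matrix.orthogonalGroup (Fin n) ℝ) (D : Matrix (Fin n) (Fin n) ℝ) :
    Uᵀ * smoother (U * D * Uᵀ) S lam * U = smoother D (S * U) lam ∧
      gramMatrix (U * D * Uᵀ) S lam = gramMatrix D (S * U) lam := by
  have hU1 : Uᵀ * U = 1 := (Matrix.mem_orthogonalGroup_iff' _ _).1 hU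
  have hU2 : ∀ {k : ℕ} (X : Matrix (Fin n) (Fin k) ℝ), Uᵀ * (U * X) = X := by
    intro k X; rw [← Matrix.mul_assoc, hU1, Matrix.one_mul]
  have hg : gramMatrix (U * D * Uᵀ) S lam = gramMatrix D (S * U) lam := by
    simp only [gramMatrix, pow_two, Matrix.transpose_mul, Matrix.mul_assoc, hU2]
  refine ⟨?_, hg⟩
  rw [smoother, smoother, hg]
  simp only [Matrix.transpose_mul, Matrix.mul_assoc, hU2, hU1, Matrix.mul_one]

end Smoother

theorem opNorm_mulVec_dotProduct_le {m n : Type*} [Fintype m] [Fintype n] [DecidableEq n]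
    {A : Matrix m n ℝ} {r : ℝ} (h : opNorm A ≤ r) (v : n → ℝ) :
    (A *ᵥ v) ⬝ᵥ (A *ᵥ v) ≤ r ^ 2 * (v ⬝ᵥ v) := by
  have h1 := (LinearMap.toContinuousLinearMap (Matrix.toEuclideanLin A)).le_of_opNorm_le h
    (WithLp.toLp 2 v)
  have h2 := pow_le_pow_left₀ (norm_nonneg _) h1 2
  rw [mul_pow, EuclideanSpace.real_norm_sq_eq, EuclideanSpace.real_norm_sq_eq] at h2
  simpa [dotProduct, pow_two, Matrix.toLpLin_apply] using h2

/-- With `u = Aᵀw`, Cauchy–Schwarz gives `|u|⁴ = (w ⬝ Au)² ≤ |w|² r² |u|²`; divide by `|u|²` when it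
is nonzero. -/
theorem opNorm_transpose_mulVec_dotProduct_le {m n : Type*} [Fintype m] [Fintype n] [DecidableEq n]
    {A : Matrix m n ℝ} {r : ℝ} (h : opNorm A ≤ r) (w : m → ℝ) :
    (Aᵀ *ᵥ w) ⬝ᵥ (Aᵀ *ᵥ w) ≤ r ^ 2 * (w ⬝ᵥ w) := by
  set u := Aᵀ *ᵥ w with hu
  have h1 := opNorm_mulVec_dotProduct_le h u
  have h2 : u ⬝ᵥ u = w ⬝ᵥ A *ᵥ u := by
    nth_rw 1 [hu, dotProduct_comm]
    rw [Matrix.dotProduct_mulVec, Matrix.vecMul_transpose, dotProduct_comm]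
  have h3 : (w ⬝ᵥ A *ᵥ u) ^ 2 ≤ (w ⬝ᵥ w) * ((A *ᵥ u) ⬝ᵥ (A *ᵥ u)) := by
    simpa [dotProduct, pow_two] using
      Finset.sum_mul_sq_le_sq_mul_sq Finset.univ w (A *ᵥ u)
  rw [← h2] at h3
  have hw : 0 ≤ w ⬝ᵥ w := Finset.sum_nonneg fun i _ => mul_self_nonneg _
  have hu0 : 0 ≤ u ⬝ᵥ u := Finset.sum_nonneg fun i _ => mul_self_nonneg _
  rcases hu0.eq_or_lt with h0 | h0
  · rw [← h0]; positivity
  · refine le_of_mul_le_mul_right ?_ h0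
    nlinarith [mul_le_mul_of_nonneg_left h1 hw]


/-! ### Lower bounds for the smoothing matrix -/

section LowerBound

variable {n s : ℕ} {lam : ℝ}

/-- A coefficient vector that reproduces the coordinate `j` in the leading block, when the leading
block of the Gram matrix is close to the identity. -/
theorem exists_leading_coefficients {m ι : Type*} [Fintype m] [Fintype ι] [DecidableEq ι]
    {V : Matrix m ι ℝ} (hV : opNorm (Vᵀ * V - 1) ≤ 1 / 2) (j : ι) {r : ℝ} :
    ∃ b : m → ℝ, Vᵀ *ᵥ b = Pi.single j r ∧ b ⬝ᵥ b ≤ 2 * r ^ 2 := by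
  have hlow : ∀ a : ι → ℝ, (a ⬝ᵥ a) / 2 ≤ (V *ᵥ a) ⬝ᵥ (V *ᵥ a) := by
    intro a
    have h1 := opNorm_mulVec_dotProduct_le hV a
    set g := (Vᵀ * V - 1) *ᵥ a with hg
    have h2 : (V *ᵥ a) ⬝ᵥ (V *ᵥ a) = a ⬝ᵥ a + a ⬝ᵥ g := by
      rw [hg, Matrix.sub_mulVec, Matrix.one_mulVec, dotProduct_sub, ← Matrix.mulVec_mulVec,
        Matrix.dotProduct_mulVec a Vᵀ, Matrix.vecMul_transpose]
      ring
    have h3 : (a ⬝ᵥ g) ^ 2 ≤ (a ⬝ᵥ a) * (g ⬝ᵥ g) := by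
      simpa [dotProduct, pow_two] using Finset.sum_mul_sq_le_sq_mul_sq Finset.univ a g
    have ha : 0 ≤ a ⬝ᵥ a := Finset.sum_nonneg fun i _ => mul_self_nonneg _
    have h4 : |a ⬝ᵥ g| ≤ (a ⬝ᵥ a) / 2 := abs_le_of_sq_le_sq (by nlinarith) (by linarith)
    rw [h2]
    linarith [neg_abs_le (a ⬝ᵥ g)]
  have hinj : Function.Injective (Vᵀ * V).mulVec := by
    intro a a' h
    have h0 : (Vᵀ * V) *ᵥ (a - a') = 0 := by rw [Matrix.mulVec_sub, sub_eq_zero]; exact h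
    have h1 := hlow (a - a')
    have h2 : (V *ᵥ (a - a')) ⬝ᵥ (V *ᵥ (a - a')) = 0 := by
      rw [← Matrix.vecMul_transpose, ← Matrix.dotProduct_mulVec, Matrix.vecMul_transpose,
        Matrix.mulVec_mulVec, h0, dotProduct_zero]
    have h3 : (a - a') ⬝ᵥ (a - a') = 0 :=
      le_antisymm (by linarith) (Finset.sum_nonneg fun i _ => mul_self_nonneg _)
    exact sub_eq_zero.1 (dotProduct_self_eq_zero.1 h3)
  have hunit : IsUnit (Vᵀ * V) := Matrix.mulVec_injective_iff_isUnit.1 hinj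
  -- The witness is `b = Va`, the solution of least norm, where `a` solves the normal equations.
  obtain ⟨a, ha⟩ := (Matrix.mulVec_surjective_iff_isUnit.2 hunit) (Pi.single j r)
  have hVa : Vᵀ *ᵥ (V *ᵥ a) = Pi.single j r := by rw [Matrix.mulVec_mulVec]; exact ha
  refine ⟨V *ᵥ a, hVa, ?_⟩
  have h1 : (V *ᵥ a) ⬝ᵥ (V *ᵥ a) = a j * r := by
    rw [← Matrix.vecMul_transpose, ← Matrix.dotProduct_mulVec, Matrix.vecMul_transpose, hVa]
    simp
  have h2 := hlow a
  have h3 : a j ^ 2 ≤ a ⬝ᵥ a := by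
    rw [pow_two]
    exact Finset.single_le_sum (f := fun i => a i * a i) (fun i _ => mul_self_nonneg _)
      (Finset.mem_univ j)
  rw [h1] at h2 ⊢
  -- From `a_j² ≤ 2 a_j r` and `(a_j - 2r)² ≥ 0` follows `|Va|² = a_j r ≤ 2r²`.
  nlinarith [sq_nonneg (a j - 2 * r)]

/-- Apply `le_smoother_quadForm` to `v = e_j` with a trial vector `b` such that `p = Sᵀb` equals
`d_j⁻¹ e_j` on the leading coordinates. Then `bᵀMb = ∑ (dᵢ² + λdᵢ) pᵢ²`. The leading part is `1 +
λ/d_j ≤ 2`. The tail is at most `2λ ∑ dᵢpᵢ²`, and the norm bounds on `V₂E` and `b` limit this to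
`4c²(λ/d_j)² ≤ 4c²`. -/
theorem smoother_diagonal_apply_ge {d : Fin n → ℝ} (hd : ∀ i, 0 ≤ d i)
    {S : Matrix (Fin s) (Fin n) ℝ} {c : ℝ} (hlam : 0 < lam)
    (hM : IsUnit (gramMatrix (Matrix.diagonal d) S lam).det)
    {V₁ : Matrix (Fin s) {j // lam < d j} ℝ} (hV₁ : V₁ = S.submatrix id Subtype.val)
    {V₂ : Matrix (Fin s) {j // d j ≤ lam} ℝ} (hV₂ : V₂ = S.submatrix id Subtype.val)
    (h1 : opNorm (V₁ᵀ * V₁ - 1) ≤ 1 / 2)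
    {E : Matrix {j // d j ≤ lam} {j // d j ≤ lam} ℝ}
    (hE : E = Matrix.diagonal fun j => √(d j.1)) (h2 : opNorm (V₂ * E) ≤ c * √lam)
    (j : Fin n) (hj : lam < d j) :
    1 / (2 + 4 * c ^ 2) ≤ smoother (Matrix.diagonal d) S lam j j := by
  obtain ⟨b, hb1, hb2⟩ := exists_leading_coefficients h1 ⟨j, hj⟩ (r := (d j)⁻¹)
  have hdj : 0 < d j := hlam.trans hj
  set p : Fin n → ℝ := Sᵀ *ᵥ b with hp
  have hp1 : ∀ i, lam < d i → p i = if i = j then (d j)⁻¹ else 0 := by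
    intro i hi
    have := congrFun hb1 ⟨i, hi⟩
    simp only [Pi.single_apply, Subtype.mk.injEq] at this
    rw [← this, hV₁]
    rfl
  have hp2 : ∑ i : {i // d i ≤ lam}, d i * p i ^ 2 ≤ 2 * c ^ 2 * lam * (d j)⁻¹ ^ 2 := by
    have h3 := opNorm_transpose_mulVec_dotProduct_le h2 b
    have h4 : ∀ i : {i // d i ≤ lam}, ((V₂ * E)ᵀ *ᵥ b) i = √(d i) * p i := by
      intro i
      rw [Matrix.transpose_mul, hE, Matrix.diagonal_transpose, ← Matrix.mulVec_mulVec,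
        Matrix.mulVec_diagonal, hV₂]
      rfl
    simp only [dotProduct, h4] at h3
    rw [mul_pow, Real.sq_sqrt hlam.le] at h3
    calc _ = ∑ i : {i // d i ≤ lam}, √(d i) * p i * (√(d i) * p i) := by
          refine Finset.sum_congr rfl fun i _ => ?_
          rw [mul_mul_mul_comm, Real.mul_self_sqrt (hd i), pow_two]
      _ ≤ c ^ 2 * lam * (2 * (d j)⁻¹ ^ 2) := h3.trans (by
          refine mul_le_mul_of_nonneg_left ?_ (by positivity)
          simpa [dotProduct] using hb2)
      _ = _ := by ring
  have hlamd : lam * (d j)⁻¹ ≤ 1 := by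
    rw [← div_eq_mul_inv]; exact (div_le_one hdj).2 hj.le
  have hlamd0 : 0 ≤ lam * (d j)⁻¹ := by positivity
  have hsplit : ∀ g : Fin n → ℝ, (∑ i, g i * p i ^ 2)
      = (g j * (d j)⁻¹ ^ 2) + ∑ i : {i // d i ≤ lam}, g i * p i ^ 2 := by
    intro g
    rw [← Finset.sum_filter_add_sum_filter_not Finset.univ (fun i => lam < d i)]
    congr 1
    · rw [Finset.sum_eq_single_of_mem j (by simp [hj])]
      · rw [hp1 j hj, if_pos rfl]
      · intro i hi hij
        rw [hp1 i (by simpa using hi), if_neg hij]; simp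
    · exact Finset.sum_subtype _ (by simp) _
  have hA : (Matrix.diagonal d).PosSemidef := Matrix.PosSemidef.diagonal hd
  have hC : 0 < 2 + 4 * c ^ 2 := by positivity
  have hone : b ⬝ᵥ (S * Matrix.diagonal d) *ᵥ Pi.single j 1 = 1 := by
    rw [← Matrix.mulVec_mulVec, Matrix.dotProduct_mulVec, ← Matrix.mulVec_transpose, ← hp,
      Matrix.diagonal_mulVec_single, dotProduct_single, hp1 j hj, if_pos rfl]
    field_simp
  have hquad : ∀ g : Fin n → ℝ, b ⬝ᵥ (S * Matrix.diagonal g * Sᵀ) *ᵥ b = ∑ i, g i * p i ^ 2 := by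
    intro g
    rw [← Matrix.mulVec_mulVec, ← hp, ← Matrix.mulVec_mulVec, Matrix.dotProduct_mulVec,
      ← Matrix.mulVec_transpose, ← hp]
    simp only [dotProduct, Matrix.mulVec_diagonal]
    exact Finset.sum_congr rfl fun i _ => by ring
  have hle : b ⬝ᵥ gramMatrix (Matrix.diagonal d) S lam *ᵥ b ≤ 2 + 4 * c ^ 2 := by
    rw [gramMatrix, Matrix.diagonal_pow, Matrix.add_mulVec, dotProduct_add, Matrix.smul_mulVec,
      dotProduct_smul, hquad, hquad, hsplit, hsplit, smul_eq_mul]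
    have h5 : ∑ i : {i // d i ≤ lam}, (d ^ 2) i * p i ^ 2
        ≤ lam * ∑ i : {i // d i ≤ lam}, d i * p i ^ 2 := by
      rw [Finset.mul_sum]
      refine Finset.sum_le_sum fun i _ => ?_
      rw [Pi.pow_apply, pow_two, mul_assoc]
      exact mul_le_mul_of_nonneg_right i.2 (mul_nonneg (hd _) (sq_nonneg _))
    have h6 : (d ^ 2) j * (d j)⁻¹ ^ 2 = 1 := by rw [Pi.pow_apply]; field_simp
    have h7 : d j * (d j)⁻¹ ^ 2 = (d j)⁻¹ := by field_simp
    have h8 : lam * ∑ i : {i // d i ≤ lam}, d i * p i ^ 2 ≤ 2 * c ^ 2 := by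
      calc _ ≤ lam * (2 * c ^ 2 * lam * (d j)⁻¹ ^ 2) := by gcongr
        _ = 2 * c ^ 2 * (lam * (d j)⁻¹) ^ 2 := by ring
        _ ≤ 2 * c ^ 2 * 1 := by
          gcongr
          exact pow_le_one₀ hlamd0 hlamd
        _ = _ := mul_one _
    rw [h6, h7, mul_add]
    linarith
  have := le_smoother_quadForm hA hlam hM (Pi.single j 1) b hC hone hle
  simpa using this

/-- By symmetry the right side is the sum of squares of row `j`, one term of which is the left side.
-/
theorem sq_apply_le_sq_apply {A : Matrix (Fin n) (Fin n) ℝ} (hA : Aᵀ = A) (j : Fin n) :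
    A j j ^ 2 ≤ (A ^ 2) j j := by
  rw [pow_two A, Matrix.mul_apply, pow_two]
  refine (Finset.single_le_sum (f := fun i => A j i * A j i) (fun i _ => mul_self_nonneg _)
      (Finset.mem_univ j)).trans_eq (Finset.sum_congr rfl fun i _ => ?_)
  rw [← congrFun (congrFun hA i) j, Matrix.transpose_apply]

/-- On the satisfiability event, `tr Δ⁴` is at least of the order of the number of empirical
eigenvalues greater than `λ`. -/
theorem card_le_trace_smoother_pow_four {A : Matrix (Fin n) (Fin n) ℝ} (hA : A.PosSemidef)
    {S : Matrix (Fin s) (Fin n) ℝ} {c : ℝ} (hlam : 0 < lam)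
    (hM : IsUnit (gramMatrix A S lam).det) (hS : IsKSatisfiable c lam A S) {k : ℕ}
    (hk : ∀ U ∈ Matrix.orthogonalGroup (Fin n) ℝ, ∀ d : Fin n → ℝ,
      A = U * Matrix.diagonal d * Uᵀ → k ≤ (Finset.univ.filter fun j => lam < d j).card) :
    k * (1 / (2 + 4 * c ^ 2)) ^ 4 ≤ (smoother A S lam ^ 4).trace := by
  -- The satisfiability condition brings its own eigenbasis, which is why `hk` covers every spectral
  -- decomposition.
  obtain ⟨U, hU, d, -, hAd, h1, h2⟩ := hS
  have hU1 : Uᵀ * U = 1 := (Matrix.mem_orthogonalGroup_iff' _ _).1 hU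
  have hU2 : U * Uᵀ = 1 := (Matrix.mem_orthogonalGroup_iff _ _).1 hU
  obtain ⟨hrot, hgram⟩ := transpose_mul_smoother_mul (S := S) (lam := lam) hU (Matrix.diagonal d)
  rw [← hAd] at hrot hgram
  have hD : (Matrix.diagonal d).PosSemidef := by
    have h := hA.conj_transpose Uᵀ
    have h3 : Uᵀ * A * Uᵀᵀ = (Uᵀ * U) * Matrix.diagonal d * (Uᵀ * U) := by
      rw [hAd, Matrix.transpose_transpose]; simp only [Matrix.mul_assoc]
    rw [h3, hU1, Matrix.one_mul, Matrix.mul_one] at h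
    exact h
  have hd : ∀ i, 0 ≤ d i := Matrix.posSemidef_diagonal_iff.1 hD
  set B := smoother (Matrix.diagonal d) (S * U) lam with hB
  have hBt : Bᵀ = B := (smoother_posSemidef hD hlam).transpose_eq
  have hB2t : (B ^ 2)ᵀ = B ^ 2 := by rw [Matrix.transpose_pow, hBt]
  have htr : (smoother A S lam ^ 4).trace = (B ^ 4).trace := by
    have h3 : ∀ m : ℕ, (Uᵀ * smoother A S lam * U) ^ m = Uᵀ * smoother A S lam ^ m * U := by
      intro m
      induction m with
      | zero => simp [hU1]
      | succ m ih =>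
        rw [pow_succ, ih, pow_succ]
        calc _ = Uᵀ * smoother A S lam ^ m * (U * Uᵀ) * smoother A S lam * U := by
              simp only [Matrix.mul_assoc]
          _ = _ := by rw [hU2, Matrix.mul_one]; simp only [Matrix.mul_assoc]
    rw [← hrot, h3, Matrix.trace_mul_comm, ← Matrix.mul_assoc, hU2, Matrix.one_mul]
  rw [htr, Matrix.trace]
  have hdiag : ∀ j, B j j ^ 4 ≤ (B ^ 4) j j := by
    intro j
    calc B j j ^ 4 = (B j j ^ 2) ^ 2 := by ring
      _ ≤ ((B ^ 2) j j) ^ 2 := pow_le_pow_left₀ (sq_nonneg _) (sq_apply_le_sq_apply hBt j) 2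
      _ ≤ ((B ^ 2) ^ 2) j j := sq_apply_le_sq_apply hB2t j
      _ = (B ^ 4) j j := by rw [← pow_mul]
  have hge : ∀ j, lam < d j → 1 / (2 + 4 * c ^ 2) ≤ B j j :=
    smoother_diagonal_apply_ge hd hlam (by rwa [← hgram]) rfl rfl h1 rfl h2
  calc _ ≤ ((Finset.univ.filter fun j => lam < d j).card : ℝ) * (1 / (2 + 4 * c ^ 2)) ^ 4 := by
        gcongr
        exact hk U hU d hAd
    _ = ∑ _j ∈ Finset.univ.filter fun j => lam < d j, (1 / (2 + 4 * c ^ 2)) ^ 4 := by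
        rw [Finset.sum_const, nsmul_eq_mul]
    _ ≤ ∑ j ∈ Finset.univ.filter fun j => lam < d j, (B ^ 4) j j := by
        refine Finset.sum_le_sum fun j hj => ?_
        exact (pow_le_pow_left₀ (by positivity) (hge j (by simpa using hj)) 4).trans (hdiag j)
    _ ≤ ∑ j, (B ^ 4) j j := by
        refine Finset.sum_le_univ_sum_of_nonneg fun j => ?_
        exact (by positivity : (0 : ℝ) ≤ B j j ^ 4).trans (hdiag j)

/-- If a matrix dominates `m Φ Φᵀ` for a matrix `Φ` with `k` columns and `Φᵀ Φ ≥ h`, then it has at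
least `k` eigenvalues greater than `λ`, for each `λ < m h`. -/
theorem le_card_eigenvalues_gt {k : ℕ} {A : Matrix (Fin n) (Fin n) ℝ}
    {Φ : Matrix (Fin n) (Fin k) ℝ} {m h : ℝ} (hm : 0 < m) (hh : 0 < h)
    (hA : ∀ v, m * ((Φᵀ *ᵥ v) ⬝ᵥ (Φᵀ *ᵥ v)) ≤ v ⬝ᵥ A *ᵥ v)
    (hΦ : ∀ a, h * (a ⬝ᵥ a) ≤ (Φ *ᵥ a) ⬝ᵥ (Φ *ᵥ a)) (hlam : lam < m * h)
    (U : Matrix (Fin n) (Fin n) ℝ) (hU : U ∈ Matrix.orthogonalGroup (Fin n) ℝ) (d : Fin n → ℝ)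
    (hAd : A = U * Matrix.diagonal d * Uᵀ) :
    k ≤ (Finset.univ.filter fun j => lam < d j).card := by
  by_contra! hlt
  have hU2 : U * Uᵀ = 1 := (Matrix.mem_orthogonalGroup_iff _ _).1 hU
  -- Dimension count: with fewer than `k` large eigenvalues, some nonzero `a` makes `Φa` orthogonal
  -- to all their eigenvectors, and there the quadratic form of `A` is at most `λ|Φa|²`.
  set L : (Fin k → ℝ) →ₗ[ℝ] ({j // lam < d j} → ℝ) :=
    Matrix.mulVecLin ((Uᵀ * Φ).submatrix Subtype.val id) with hL
  have hker := L.ker_ne_bot_of_finrank_lt (by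
    rw [Module.finrank_fintype_fun_eq_card, Module.finrank_fintype_fun_eq_card, Fintype.card_fin,
      Fintype.card_subtype]
    exact hlt)
  obtain ⟨a, ha, ha0⟩ := Submodule.exists_mem_ne_zero_of_ne_bot hker
  set v := Φ *ᵥ a with hv
  set w := Uᵀ *ᵥ v with hw
  have hw0 : ∀ j, lam < d j → w j = 0 := by
    intro j hj
    have h1 := congrFun (LinearMap.mem_ker.1 ha) ⟨j, hj⟩
    rw [hw, hv, Matrix.mulVec_mulVec]
    exact h1
  have hww : w ⬝ᵥ w = v ⬝ᵥ v := by
    nth_rw 1 [hw]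
    rw [Matrix.mulVec_transpose, ← Matrix.dotProduct_mulVec, hw, Matrix.mulVec_mulVec, hU2,
      Matrix.one_mulVec]
  have hquad : v ⬝ᵥ A *ᵥ v ≤ lam * (v ⬝ᵥ v) := by
    have h1 : v ⬝ᵥ A *ᵥ v = ∑ j, d j * w j ^ 2 := by
      rw [hAd, ← Matrix.mulVec_mulVec, ← hw, ← Matrix.mulVec_mulVec, Matrix.dotProduct_mulVec,
        ← Matrix.mulVec_transpose, ← hw]
      simp only [dotProduct, Matrix.mulVec_diagonal]
      exact Finset.sum_congr rfl fun i _ => by ring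
    rw [h1, ← hww, dotProduct, Finset.mul_sum]
    refine Finset.sum_le_sum fun j _ => ?_
    by_cases hj : lam < d j
    · rw [hw0 j hj]; simp
    · rw [← pow_two]
      exact mul_le_mul_of_nonneg_right (not_lt.1 hj) (sq_nonneg _)
  have haa : 0 < a ⬝ᵥ a := by
    refine lt_of_le_of_ne (Finset.sum_nonneg fun i _ => mul_self_nonneg _) fun h0 => ha0 ?_
    exact dotProduct_self_eq_zero.1 h0.symm
  have hva : h * (a ⬝ᵥ a) ≤ v ⬝ᵥ v := hΦ a
  have hvv : 0 < v ⬝ᵥ v := (mul_pos hh haa).trans_le hva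
  set g := Φᵀ *ᵥ v with hg
  have hag : a ⬝ᵥ g = v ⬝ᵥ v := by
    rw [hg, Matrix.dotProduct_mulVec, Matrix.vecMul_transpose]
  have hcs : (a ⬝ᵥ g) ^ 2 ≤ (a ⬝ᵥ a) * (g ⬝ᵥ g) := by
    simpa [dotProduct, pow_two] using Finset.sum_mul_sq_le_sq_mul_sq Finset.univ a g
  have hAv : m * (g ⬝ᵥ g) ≤ lam * (v ⬝ᵥ v) := (hA v).trans hquad
  -- Cauchy–Schwarz gives `|v|⁴ ≤ |a|²|Φᵀv|²`, and `|v|² ≥ h|a|²` eliminates `a`. Hence `mh|v|² ≤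
  -- λ|v|²`, against `λ < mh`.
  have hgg : h * (v ⬝ᵥ v) ≤ g ⬝ᵥ g := by
    rw [hag] at hcs
    have h3 : h * (a ⬝ᵥ a) * (v ⬝ᵥ v) ≤ (a ⬝ᵥ a) * (g ⬝ᵥ g) := by
      calc _ ≤ (v ⬝ᵥ v) * (v ⬝ᵥ v) := by gcongr
        _ = (v ⬝ᵥ v) ^ 2 := by ring
        _ ≤ _ := hcs
    refine le_of_mul_le_mul_left ?_ haa
    linarith
  have h4 : m * (h * (v ⬝ᵥ v)) ≤ lam * (v ⬝ᵥ v) := (by gcongr : _ ≤ m * (g ⬝ᵥ g)).trans hAv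
  nlinarith

/-- A symmetric matrix with entries close to those of the identity is bounded below. -/
theorem half_dotProduct_le_of_entries {k : ℕ} {G : Matrix (Fin k) (Fin k) ℝ}
    (hG : ∀ a b, |G a b - (1 : Matrix (Fin k) (Fin k) ℝ) a b| ≤ 1 / (2 * k)) (a : Fin k → ℝ) :
    (a ⬝ᵥ a) / 2 ≤ a ⬝ᵥ G *ᵥ a := by
  have h1 : a ⬝ᵥ a - a ⬝ᵥ G *ᵥ a = ∑ i, ∑ j, a i * (((1 : Matrix _ _ ℝ) i j - G i j) * a j) := by
    have : a ⬝ᵥ a - a ⬝ᵥ G *ᵥ a = a ⬝ᵥ (1 - G) *ᵥ a := by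
      rw [Matrix.sub_mulVec, Matrix.one_mulVec, dotProduct_sub]
    rw [this]
    simp only [dotProduct, Matrix.mulVec, Finset.mul_sum, Matrix.sub_apply]
  have h2 : ∑ i, ∑ j, a i * (((1 : Matrix _ _ ℝ) i j - G i j) * a j)
      ≤ ∑ i, ∑ j, 1 / (2 * (k : ℝ)) * (|a i| * |a j|) := by
    refine Finset.sum_le_sum fun i _ => Finset.sum_le_sum fun j _ => ?_
    calc _ ≤ |a i * (((1 : Matrix _ _ ℝ) i j - G i j) * a j)| := le_abs_self _
      _ = |G i j - (1 : Matrix _ _ ℝ) i j| * (|a i| * |a j|) := by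
          rw [abs_mul, abs_mul, abs_sub_comm]; ring
      _ ≤ _ := by
          gcongr
          exact hG i j
  have h3 : ∑ i, ∑ j, 1 / (2 * (k : ℝ)) * (|a i| * |a j|) = 1 / (2 * k) * (∑ i, |a i|) ^ 2 := by
    rw [pow_two, Finset.sum_mul_sum]
    simp only [Finset.mul_sum]
  -- Cauchy–Schwarz; this factor `k` is what the entrywise tolerance `1/(2k)` compensates.
  have h4 : (∑ i, |a i|) ^ 2 ≤ k * (a ⬝ᵥ a) := by
    have := sq_sum_le_card_mul_sum_sq (s := Finset.univ) (f := fun i => |a i|)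
    simpa [dotProduct, pow_two] using this
  rcases Nat.eq_zero_or_pos k with rfl | hk
  · simp
  · have hk' : (0 : ℝ) < k := by exact_mod_cast hk
    have h5 : 1 / (2 * (k : ℝ)) * (∑ i, |a i|) ^ 2 ≤ (a ⬝ᵥ a) / 2 := by
      calc _ ≤ 1 / (2 * (k : ℝ)) * (k * (a ⬝ᵥ a)) := by gcongr
        _ = _ := by field_simp
    linarith

end LowerBound

/-! ### The hat matrix and the quadratic form of the statistic -/

section Hat

variable {d n s : ℕ} {𝒳 : Set (EuclideanSpace ℝ (Fin d))} {x : Fin n → 𝒳}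

theorem hat_transpose (x : Fin n → 𝒳) : (hat x)ᵀ = hat x := by
  rw [hat]
  simp only [Matrix.transpose_mul, Matrix.transpose_nonsing_inv, Matrix.transpose_transpose,
    Matrix.mul_assoc]

theorem one_sub_hat_transpose (x : Fin n → 𝒳) : (1 - hat x)ᵀ = 1 - hat x := by
  rw [Matrix.transpose_sub, Matrix.transpose_one, hat_transpose]

theorem hat_mul_design_transpose (hx : IsUnit (design x * (design x)ᵀ).det) :
    hat x * (design x)ᵀ = (design x)ᵀ := by
  rw [hat, Matrix.mul_assoc, Matrix.mul_assoc, Matrix.nonsing_inv_mul _ hx, Matrix.mul_one]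

theorem hat_mul_self (hx : IsUnit (design x * (design x)ᵀ).det) : hat x * hat x = hat x := by
  nth_rw 2 [hat]
  rw [← Matrix.mul_assoc, ← Matrix.mul_assoc, hat_mul_design_transpose hx, hat]

theorem trace_hat (hx : IsUnit (design x * (design x)ᵀ).det) : (hat x).trace = d + 1 := by
  rw [hat, Matrix.trace_mul_comm, ← Matrix.mul_assoc, Matrix.mul_nonsing_inv _ hx,
    Matrix.trace_one]
  simp

/-- The values of a linear function form a combination of the rows of the design matrix, and `H`
fixes these. -/
theorem one_sub_hat_mulVec_linear (hx : IsUnit (design x * (design x)ᵀ).det) {f : 𝒳 → ℝ}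
    (hf : IsLinearFun f) : (1 - hat x) *ᵥ (fun i => f (x i)) = 0 := by
  obtain ⟨b0, b1, hb⟩ := hf
  have h : (fun i => f (x i)) = (design x)ᵀ *ᵥ Fin.cons b0 (fun j => b1 j) := by
    funext i
    rw [hb]
    simp [Matrix.mulVec, dotProduct, Fin.sum_univ_succ, design, mul_comm]
  rw [h, Matrix.mulVec_mulVec, Matrix.sub_mul, Matrix.one_mul, hat_mul_design_transpose hx,
    sub_self, Matrix.zero_mulVec]

/-- The matrix `(I - H) Δ² (I - H)` of the statistic, as a quadratic form in the responses. -/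
def residualMatrix (K : 𝒳 → 𝒳 → ℝ) (x : Fin n → 𝒳) (S : Matrix (Fin s) (Fin n) ℝ) (lam : ℝ) :
    Matrix (Fin n) (Fin n) ℝ :=
  (1 - hat x) * smoother (kernelMatrix K x) S lam ^ 2 * (1 - hat x)

variable {K : 𝒳 → 𝒳 → ℝ} {S : Matrix (Fin s) (Fin n) ℝ} {lam : ℝ}

/-- The fitted values are `Δr`, since the factor `n⁻¹` in the coefficients cancels the normalization
of the kernel matrix. No invertibility is needed: both sides use the same default inverse, and `Δ`
stays symmetric. The identity therefore also serves for measurability on the whole space. -/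
theorem linStat_eq (hA : (kernelMatrix K x).PosSemidef) (hlam : 0 < lam) (y : Fin n → ℝ) :
    linStat K x S lam y = (y ⬝ᵥ residualMatrix K x S lam *ᵥ y) / n := by
  set Δ := smoother (kernelMatrix K x) S lam with hΔ
  set r := (1 - hat x) *ᵥ y with hr
  have hΔt : Δᵀ = Δ := (smoother_posSemidef hA hlam).transpose_eq
  clear_value r
  have h1 : ∀ j, estimator K x S lam r (x j) = (Δ *ᵥ r) j := by
    intro j
    have hn : (n : ℝ) ≠ 0 := Nat.cast_ne_zero.2 (Fin.pos j).ne'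
    have h2 : Δ *ᵥ r = (n : ℝ) • kernelMatrix K x *ᵥ ((S)ᵀ *ᵥ coef (kernelMatrix K x) S lam r) := by
      rw [coef, Matrix.mulVec_smul, Matrix.mulVec_smul, smul_smul, mul_inv_cancel₀ hn, one_smul,
        Matrix.mulVec_mulVec, Matrix.mulVec_mulVec, hΔ, smoother]
      simp only [Matrix.mul_assoc]
    rw [h2, estimator, Pi.smul_apply, Matrix.mulVec, dotProduct, Finset.smul_sum]
    refine Finset.sum_congr rfl fun i _ => ?_
    rw [← congrFun (congrFun hA.transpose_eq j) i, Matrix.transpose_apply, kernelMatrix,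
      Matrix.of_apply, smul_eq_mul]
    field_simp
  rw [linStat, empNormSq]
  simp only [← hr, h1]
  have h3 : ∑ i, (Δ *ᵥ r) i ^ 2 = y ⬝ᵥ residualMatrix K x S lam *ᵥ y := by
    have : ∑ i, (Δ *ᵥ r) i ^ 2 = (Δ *ᵥ r) ⬝ᵥ (Δ *ᵥ r) := by simp [dotProduct, pow_two]
    rw [this, residualMatrix, ← hΔ, ← Matrix.mulVec_mulVec, ← hr, ← Matrix.mulVec_mulVec,
      Matrix.dotProduct_mulVec y, ← Matrix.mulVec_transpose, one_sub_hat_transpose, ← hr, pow_two,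
      ← Matrix.mulVec_mulVec, Matrix.dotProduct_mulVec r, ← Matrix.mulVec_transpose, hΔt]
  rw [h3]
  ring

theorem linStat_eq_noise (hA : (kernelMatrix K x).PosSemidef) (hlam : 0 < lam)
    (hx : IsUnit (design x * (design x)ᵀ).det) {f : 𝒳 → ℝ} (hf : IsLinearFun f)
    {y e : Fin n → ℝ} (hy : ∀ i, y i = f (x i) + e i) :
    linStat K x S lam y = (e ⬝ᵥ residualMatrix K x S lam *ᵥ e) / n := by
  have h : (1 - hat x) *ᵥ y = (1 - hat x) *ᵥ e := by
    have : y = (fun i => f (x i)) + e := funext hy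
    rw [this, Matrix.mulVec_add, one_sub_hat_mulVec_linear hx hf, zero_add]
  rw [← linStat_eq hA hlam, linStat, linStat, h]

theorem residualMatrix_posSemidef (hA : (kernelMatrix K x).PosSemidef) (hlam : 0 < lam) :
    (residualMatrix K x S lam).PosSemidef :=
  ((smoother_posSemidef hA hlam).pow 2).conj_symm (one_sub_hat_transpose x)

theorem hat_posSemidef (hx : IsUnit (design x * (design x)ᵀ).det) : (hat x).PosSemidef :=
  Matrix.posSemidef_of_isSymm_of_isIdempotentElem (hat_transpose x) (hat_mul_self hx)

/-- `1 - Δ² = (1 - Δ) + (Δ - Δ²)`. -/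
theorem one_sub_smoother_sq_posSemidef (hA : (kernelMatrix K x).PosSemidef) (hlam : 0 < lam)
    (hM : IsUnit (gramMatrix (kernelMatrix K x) S lam).det) :
    (1 - smoother (kernelMatrix K x) S lam ^ 2).PosSemidef := by
  have h := smoother_sub_sq_posSemidef hA hlam hM
  have ht := (smoother_posSemidef (S := S) hA hlam).transpose_eq
  convert! (Matrix.one_sub_posSemidef_of_sub_sq ht h).add h using 1
  rw [pow_two]; abel

/-- `1 - R = H + Q(1 - Δ²)Q` with `Q = 1 - H`, a projection. -/
theorem one_sub_residualMatrix_posSemidef (hA : (kernelMatrix K x).PosSemidef) (hlam : 0 < lam)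
    (hx : IsUnit (design x * (design x)ᵀ).det)
    (hM : IsUnit (gramMatrix (kernelMatrix K x) S lam).det) :
    (1 - residualMatrix K x S lam).PosSemidef := by
  have h1 := (one_sub_smoother_sq_posSemidef hA hlam hM).conj_symm (one_sub_hat_transpose x)
  convert! (hat_posSemidef hx).add h1 using 1
  have h2 := hat_mul_self hx
  rw [residualMatrix]
  have h3 : (1 - hat x) * (1 - hat x) = 1 - hat x := by
    rw [Matrix.sub_mul, Matrix.mul_sub, Matrix.mul_sub, h2]; simp
  have h4 : ∀ B : Matrix (Fin n) (Fin n) ℝ, (1 - hat x) * (1 - B) * (1 - hat x)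
      = (1 - hat x) * (1 - hat x) - (1 - hat x) * B * (1 - hat x) := fun B => by noncomm_ring
  rw [h4, h3]
  abel

/-- The trace of `H B H` for `B ≤ I`. -/
theorem trace_hat_mul_mul_hat_le (hx : IsUnit (design x * (design x)ᵀ).det)
    {B : Matrix (Fin n) (Fin n) ℝ} (hB : (1 - B).PosSemidef) :
    (hat x * B * hat x).trace ≤ d + 1 := by
  have h := (hB.conj_symm (hat_transpose x)).trace_nonneg
  rw [Matrix.mul_sub, Matrix.sub_mul, Matrix.mul_one, hat_mul_self hx, Matrix.trace_sub,
    trace_hat hx] at h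
  linarith

/-- Put `B = Δ²` and `Q = 1 - H`. Then `tr QB²Q = tr B² - tr HB²H`, and `tr QB²Q - tr (QBQ)² = tr
QBHBQ = tr HBQBH ≥ 0`. Both corrections are traces of `HCH` with `C ≤ I`, hence at most `tr H = d +
1`. -/
theorem trace_comparison (hA : (kernelMatrix K x).PosSemidef) (hlam : 0 < lam)
    (hx : IsUnit (design x * (design x)ᵀ).det)
    (hM : IsUnit (gramMatrix (kernelMatrix K x) S lam).det) :
    (smoother (kernelMatrix K x) S lam ^ 4).trace - (d + 1)
        ≤ ((1 - hat x) * smoother (kernelMatrix K x) S lam ^ 4 * (1 - hat x)).trace ∧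
      (residualMatrix K x S lam ^ 2).trace
        ≤ ((1 - hat x) * smoother (kernelMatrix K x) S lam ^ 4 * (1 - hat x)).trace ∧
      ((1 - hat x) * smoother (kernelMatrix K x) S lam ^ 4 * (1 - hat x)).trace
        ≤ (residualMatrix K x S lam ^ 2).trace + (d + 1) := by
  have hΔ := smoother_posSemidef (S := S) hA hlam
  have h1B := one_sub_smoother_sq_posSemidef hA hlam hM
  have hB : (smoother (kernelMatrix K x) S lam ^ 2).PosSemidef := hΔ.pow 2
  have hΔt := hΔ.transpose_eq
  have hBmB : (smoother (kernelMatrix K x) S lam ^ 2 - smoother (kernelMatrix K x) S lam ^ 2 *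
      smoother (kernelMatrix K x) S lam ^ 2).PosSemidef := by
    convert! h1B.conj_symm hΔt using 1
    noncomm_ring
  rw [residualMatrix, show smoother (kernelMatrix K x) S lam ^ 4 =
    smoother (kernelMatrix K x) S lam ^ 2 * smoother (kernelMatrix K x) S lam ^ 2 by
      rw [← pow_add]]
  generalize smoother (kernelMatrix K x) S lam ^ 2 = B at *
  have hBt := hB.transpose_eq
  have h1BB : (1 - B * B).PosSemidef := by
    convert! h1B.add hBmB using 1
    abel
  have hQt := one_sub_hat_transpose x
  have hHH := hat_mul_self hx
  have hQQ : (1 - hat x) * (1 - hat x) = 1 - hat x := by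
    rw [Matrix.sub_mul, Matrix.mul_sub, Matrix.mul_sub, hHH]; simp
  have hH := hat_posSemidef hx
  have htH := trace_hat_mul_mul_hat_le hx h1BB
  have hcyc : ∀ P : Matrix (Fin n) (Fin n) ℝ, P * P = P → ∀ C : Matrix (Fin n) (Fin n) ℝ,
      (P * C * P).trace = (P * C).trace := by
    intro P hP C
    rw [Matrix.trace_mul_comm, ← Matrix.mul_assoc, hP]
  have ha : ((1 - hat x) * (B * B) * (1 - hat x)).trace
      = (B * B).trace - (hat x * (B * B) * hat x).trace := by
    rw [hcyc _ hQQ, hcyc _ hHH, Matrix.sub_mul, Matrix.one_mul, Matrix.trace_sub]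
  have hBHB : (B * hat x * B).PosSemidef := hH.conj_symm hBt
  have hv : (((1 - hat x) * B * (1 - hat x)) ^ 2).trace
      = ((1 - hat x) * (B * (1 - hat x) * B) * (1 - hat x)).trace := by
    congr 1
    rw [pow_two]
    calc _ = (1 - hat x) * B * ((1 - hat x) * (1 - hat x)) * B * (1 - hat x) := by
          simp only [Matrix.mul_assoc]
      _ = _ := by rw [hQQ]; simp only [Matrix.mul_assoc]
  have hav : ((1 - hat x) * (B * B) * (1 - hat x)).trace
      = (((1 - hat x) * B * (1 - hat x)) ^ 2).trace
        + ((1 - hat x) * (B * hat x * B) * (1 - hat x)).trace := by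
    rw [hv, ← Matrix.trace_add]
    congr 1
    noncomm_ring
  have hswap : ((1 - hat x) * (B * hat x * B) * (1 - hat x)).trace
      = (hat x * (B * (1 - hat x) * B) * hat x).trace := by
    have hc := Matrix.trace_mul_comm ((1 - hat x) * B) (hat x * B)
    rw [hcyc _ hQQ, hcyc _ hHH]
    simp only [Matrix.mul_assoc] at hc ⊢
    exact hc
  have hle : (hat x * (B * (1 - hat x) * B) * hat x).trace ≤ d + 1 := by
    refine trace_hat_mul_mul_hat_le hx ?_
    -- `1 - BQB = (1 - B²) + BHB`.
    convert! h1BB.add hBHB using 1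
    noncomm_ring
  have hnn : 0 ≤ ((1 - hat x) * (B * hat x * B) * (1 - hat x)).trace :=
    (hBHB.conj_symm hQt).trace_nonneg
  refine ⟨by linarith, by linarith, by linarith⟩

end Hat

/-! ### Normal approximation of a normalized quadratic form -/

theorem abs_exp_neg_sub_exp_neg_le {a b : ℝ} (ha : 0 ≤ a) (hab : a ≤ b) :
    |Real.exp (-a) - Real.exp (-b)| ≤ b - a := by
  have h1 : Real.exp (-b) = Real.exp (-a) * Real.exp (-(b - a)) := by
    rw [← Real.exp_add]; congr 1; ring
  have h2 := Real.add_one_le_exp (-(b - a))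
  have h3 : Real.exp (-a) ≤ 1 := Real.exp_le_one_iff.2 (by linarith)
  have h4 : Real.exp (-(b - a)) ≤ 1 := Real.exp_le_one_iff.2 (by linarith)
  rw [h1, abs_of_nonneg (by nlinarith [Real.exp_pos (-a)])]
  nlinarith [Real.exp_pos (-a)]

/-- The normalizer `b` is kept apart from `v = tr A²` so that both standardizations are covered. One
error `η/2` comes from replacing the quadratic form by a normal variable of variance `v/b`, another
from replacing `v/b` by `1`. -/
theorem exists_norm_charFun_normalized_quadForm_le (t D : ℝ) (hD : 0 ≤ D) {η : ℝ} (hη : 0 < η) :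
    ∃ L : ℝ, 0 < L ∧ ∀ {n : ℕ} {A : Matrix (Fin n) (Fin n) ℝ}, A.PosSemidef →
      (1 - A).PosSemidef → ∀ b : ℝ, L ≤ b → (A ^ 2).trace ≤ b → b ≤ (A ^ 2).trace + D →
      ‖∫ e, Complex.exp (t * (((e ⬝ᵥ A *ᵥ e - A.trace) / √(2 * b) : ℝ) : ℂ) * Complex.I)
        ∂gaussianPi (Fin n) - Complex.exp ((-(t ^ 2 / 2) : ℝ) : ℂ)‖ ≤ η := by
  obtain ⟨δ, hδ, h⟩ := exists_norm_integral_exp_quadForm_sub_exp_le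
    (r := η / (t ^ 2 + 1)) (by positivity)
  -- The first threshold bounds the variance error `t²(b - v)/(2b)` and, through `+ 1`, keeps `b`
  -- positive; the second brings the scaled eigenvalues, all at most `1` before scaling, below `δ`.
  refine ⟨max (t ^ 2 * D / η + 1) (t ^ 2 / δ ^ 2), lt_max_of_lt_left (by positivity),
    fun {n A} hA hA1 b hLb hvb hbv => ?_⟩
  have hL1 : t ^ 2 * D / η + 1 ≤ b := (le_max_left _ _).trans hLb
  have hL2 : t ^ 2 / δ ^ 2 ≤ b := (le_max_right _ _).trans hLb
  have hb : 0 < b := lt_of_lt_of_le (by positivity) hL1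
  have hsq : √(2 * b) ^ 2 = 2 * b := Real.sq_sqrt (by positivity)
  have hsqpos : 0 < √(2 * b) := Real.sqrt_pos.2 (by positivity)
  set v := (A ^ 2).trace with hv
  have hv0 : 0 ≤ v := (hA.pow 2).trace_nonneg
  have ht2 : (t / √(2 * b)) ^ 2 * v = t ^ 2 * v / (2 * b) := by
    rw [div_pow, hsq]; ring
  have h1 := h hA.isHermitian (t / √(2 * b)) fun i => by
    have hi0 : 0 ≤ hA.isHermitian.eigenvalues i := hA.eigenvalues_nonneg i
    have hi1 := hA.isHermitian.eigenvalues_le_one hA1 i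
    refine abs_le_of_sq_le_sq ?_ hδ.le
    rw [mul_pow, div_pow, hsq]
    have h2 : hA.isHermitian.eigenvalues i ^ 2 ≤ 1 := pow_le_one₀ hi0 hi1
    have h3 : t ^ 2 / (2 * b) ≤ δ ^ 2 := by
      rw [div_le_iff₀ (by positivity)] at hL2 ⊢
      nlinarith [sq_nonneg δ]
    calc _ ≤ δ ^ 2 * 1 := mul_le_mul h3 h2 (sq_nonneg _) (sq_nonneg _)
      _ = _ := mul_one _
  rw [← hv, ht2] at h1
  have hfrac : t ^ 2 * v / (2 * b) ≤ t ^ 2 / 2 := by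
    rw [div_le_div_iff₀ (by positivity) two_pos]
    nlinarith [sq_nonneg t]
  have hfrac0 : 0 ≤ t ^ 2 * v / (2 * b) := by positivity
  have h2 : ‖Complex.exp ((-(t ^ 2 * v / (2 * b)) : ℝ) : ℂ)
      - Complex.exp ((-(t ^ 2 / 2) : ℝ) : ℂ)‖ ≤ η / 2 := by
    rw [← Complex.ofReal_exp, ← Complex.ofReal_exp, ← Complex.ofReal_sub, Complex.norm_real,
      Real.norm_eq_abs]
    refine (abs_exp_neg_sub_exp_neg_le hfrac0 hfrac).trans ?_
    have h3 : t ^ 2 / 2 - t ^ 2 * v / (2 * b) = t ^ 2 * (b - v) / (2 * b) := by field_simp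
    have h4 : t ^ 2 * D ≤ η * b := by
      have : t ^ 2 * D / η ≤ b := by linarith
      rwa [div_le_iff₀ hη, mul_comm b] at this
    rw [h3, div_le_div_iff₀ (by positivity) two_pos]
    nlinarith [sq_nonneg t]
  have h3 : η / (t ^ 2 + 1) * (t ^ 2 * v / (2 * b)) ≤ η / 2 := by
    calc _ ≤ η / (t ^ 2 + 1) * (t ^ 2 / 2) := by gcongr
      _ ≤ η / 2 := by
        rw [div_mul_div_comm, div_le_div_iff₀ (by positivity) two_pos]
        nlinarith [sq_nonneg t]
  have hint : ∀ e : Fin n → ℝ, (t : ℂ) * (((e ⬝ᵥ A *ᵥ e - A.trace) / √(2 * b) : ℝ) : ℂ)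
      = ((t / √(2 * b) : ℝ) : ℂ) * ((e ⬝ᵥ A *ᵥ e - A.trace : ℝ) : ℂ) := by
    intro e
    push_cast
    ring
  simp_rw [hint]
  calc _ ≤ _ + _ := norm_sub_le_norm_sub_add_norm_sub _ _ _
    _ ≤ η := by linarith


/-! ### Measurability of matrix expressions -/

section Measurability

variable {Z : Type*} [MeasurableSpace Z]

/-- A random matrix with measurable entries. -/
def MeasurableEntries {m n : Type*} (M : Z → Matrix m n ℝ) : Prop :=
  ∀ i j, Measurable fun z => M z i j

namespace MeasurableEntries

variable {n : Type*} [Fintype n]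

theorem mul {l m n : Type*} [Fintype m] {M : Z → Matrix l m ℝ} {N : Z → Matrix m n ℝ} (hM : MeasurableEntries M)
    (hN : MeasurableEntries N) : MeasurableEntries fun z => M z * N z := fun i j => by
  simp only [Matrix.mul_apply]
  exact Finset.measurable_sum _ fun k _ => (hM i k).mul (hN k j)

theorem transpose {l m : Type*} {M : Z → Matrix l m ℝ} (hM : MeasurableEntries M) :
    MeasurableEntries fun z => (M z)ᵀ :=
  fun i j => hM j i

theorem add {l m : Type*} {M N : Z → Matrix l m ℝ} (hM : MeasurableEntries M)
    (hN : MeasurableEntries N) : MeasurableEntries fun z => M z + N z :=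
  fun i j => (hM i j).add (hN i j)

theorem sub {l m : Type*} {M N : Z → Matrix l m ℝ} (hM : MeasurableEntries M)
    (hN : MeasurableEntries N) : MeasurableEntries fun z => M z - N z :=
  fun i j => (hM i j).sub (hN i j)

theorem smul {l m : Type*} {M : Z → Matrix l m ℝ} (hM : MeasurableEntries M) (a : ℝ) :
    MeasurableEntries fun z => a • M z :=
  fun i j => (hM i j).const_smul a

theorem const {l m : Type*} (A : Matrix l m ℝ) : MeasurableEntries fun _ : Z => A :=
  fun _ _ => measurable_const

theorem trace {M : Z → Matrix n n ℝ} (hM : MeasurableEntries M) :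
    Measurable fun z => (M z).trace :=
  Finset.measurable_sum _ fun i _ => hM i i

variable [DecidableEq n]

theorem pow {M : Z → Matrix n n ℝ} (hM : MeasurableEntries M) (k : ℕ) :
    MeasurableEntries fun z => M z ^ k := by
  induction k with
  | zero => simpa only [pow_zero] using const 1
  | succ k ih => simpa only [pow_succ] using ih.mul hM

theorem det {M : Z → Matrix n n ℝ} (hM : MeasurableEntries M) :
    Measurable fun z => (M z).det := by
  simp only [Matrix.det_apply]
  exact Finset.measurable_sum _ fun σ _ =>
    (Finset.measurable_prod _ fun i _ => hM _ _).const_smul _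

/-- The adjugate formula holds at singular matrices too, where both sides are `0`, so measurability
needs no restriction to the invertible ones. -/
theorem inv {M : Z → Matrix n n ℝ} (hM : MeasurableEntries M) :
    MeasurableEntries fun z => (M z)⁻¹ := fun i j => by
  simp only [Matrix.inv_def, Ring.inverse_eq_inv', Matrix.smul_apply, smul_eq_mul,
    Matrix.adjugate_apply]
  refine hM.det.inv.mul (det fun a b => ?_)
  by_cases h : a = j
  · subst h; simp only [Matrix.updateRow_self]; exact measurable_const
  · simp only [Matrix.updateRow_ne h]; exact hM a b

end MeasurableEntries

theorem MeasurableEntries.gramMatrix {n s : ℕ} {A : Z → Matrix (Fin n) (Fin n) ℝ}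
    {S : Z → Matrix (Fin s) (Fin n) ℝ} (hA : MeasurableEntries A) (hS : MeasurableEntries S)
    (lam : ℝ) : MeasurableEntries fun z => gramMatrix (A z) (S z) lam :=
  ((hS.mul (hA.pow 2)).mul hS.transpose).add (((hS.mul hA).mul hS.transpose).smul lam)

theorem MeasurableEntries.smoother {n s : ℕ} {A : Z → Matrix (Fin n) (Fin n) ℝ}
    {S : Z → Matrix (Fin s) (Fin n) ℝ} (hA : MeasurableEntries A) (hS : MeasurableEntries S)
    (lam : ℝ) : MeasurableEntries fun z => smoother (A z) (S z) lam :=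
  (((hA.mul hS.transpose).mul (hA.gramMatrix hS lam).inv).mul hS).mul hA

theorem measurableEntries_design {d n : ℕ} {𝒳 : Set (EuclideanSpace ℝ (Fin d))}
    {x : Z → Fin n → 𝒳} (hx : Measurable x) : MeasurableEntries fun z => design (x z) := by
  intro a i
  refine Fin.cases ?_ (fun j => ?_) a
  · simp only [design, Matrix.of_apply, Fin.cons_zero]; exact measurable_const
  · simp only [design, Matrix.of_apply, Fin.cons_succ]
    have h : Measurable fun z => ((x z i : 𝒳) : EuclideanSpace ℝ (Fin d)) :=
      measurable_subtype_coe.comp ((measurable_pi_apply i).comp hx)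
    fun_prop

theorem measurableEntries_hat {d n : ℕ} {𝒳 : Set (EuclideanSpace ℝ (Fin d))}
    {x : Z → Fin n → 𝒳} (hx : Measurable x) : MeasurableEntries fun z => hat (x z) :=
  ((measurableEntries_design hx).transpose.mul
    ((measurableEntries_design hx).mul (measurableEntries_design hx).transpose).inv).mul
    (measurableEntries_design hx)

end Measurability

/-! ### The Mercer expansion and the empirical kernel matrix -/

section Mercer

variable {𝒳 : Type*} [MeasurableSpace 𝒳] {PX : Measure 𝒳} {K : 𝒳 → 𝒳 → ℝ} {ev : ℕ → ℝ}
  {φ : ℕ → 𝒳 → ℝ} {n : ℕ}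

theorem IsMercerExpansion.measurable_kernel (hK : IsMercerExpansion PX K ev φ) :
    Measurable fun p : 𝒳 × 𝒳 => K p.1 p.2 := by
  refine measurable_of_tendsto_metrizable
    (f := fun m (p : 𝒳 × 𝒳) => ∑ i ∈ Finset.range m, ev i * φ i p.1 * φ i p.2) (fun m => ?_)
    (tendsto_pi_nhds.2 fun p => (hK.expansion p.1 p.2).tendsto_sum_nat)
  refine Finset.measurable_sum _ fun i _ => ?_
  exact (((hK.measurable i).comp measurable_fst).const_mul _).mul
    ((hK.measurable i).comp measurable_snd)

theorem IsMercerExpansion.measurableEntries_kernelMatrix (hK : IsMercerExpansion PX K ev φ)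
    {Z : Type*} [MeasurableSpace Z] {x : Z → Fin n → 𝒳} (hx : Measurable x) :
    MeasurableEntries fun z => kernelMatrix K (x z) := fun i j => by
  simp only [kernelMatrix, Matrix.of_apply]
  exact (hK.measurable_kernel.comp (((measurable_pi_apply i).comp hx).prodMk
    ((measurable_pi_apply j).comp hx))).const_mul _

/-- Writing the form as a series of nonnegative terms gives positivity at once, and lower bounds by
truncation. -/
theorem IsMercerExpansion.hasSum_quadForm (hK : IsMercerExpansion PX K ev φ) (x : Fin n → 𝒳)
    (v : Fin n → ℝ) :
    HasSum (fun l => (n : ℝ)⁻¹ * (ev l * (∑ i, v i * φ l (x i)) ^ 2))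
      (v ⬝ᵥ kernelMatrix K x *ᵥ v) := by
  have h : HasSum (fun l => ∑ i, ∑ j, v i * v j * (ev l * φ l (x i) * φ l (x j)))
      (∑ i, ∑ j, v i * v j * K (x i) (x j)) :=
    hasSum_sum fun i _ => hasSum_sum fun j _ => (hK.expansion (x i) (x j)).mul_left _
  convert! h.mul_left (n : ℝ)⁻¹ using 1
  · funext l
    congr 1
    rw [pow_two, Finset.sum_mul_sum, Finset.mul_sum]
    refine Finset.sum_congr rfl fun i _ => ?_
    rw [Finset.mul_sum]
    exact Finset.sum_congr rfl fun j _ => by ring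
  · simp only [dotProduct, Matrix.mulVec, kernelMatrix, Matrix.of_apply, Finset.mul_sum]
    exact Finset.sum_congr rfl fun i _ => Finset.sum_congr rfl fun j _ => by ring

theorem IsMercerExpansion.kernelMatrix_posSemidef (hK : IsMercerExpansion PX K ev φ)
    (x : Fin n → 𝒳) : (kernelMatrix K x).PosSemidef := by
  refine Matrix.PosSemidef.of_dotProduct_mulVec_nonneg ?_ fun v => ?_
  · ext i j
    have h : K (x j) (x i) = K (x i) (x j) := by
      refine (hK.expansion (x j) (x i)).unique ?_
      convert! hK.expansion (x i) (x j) using 2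
      ring
    simp [kernelMatrix, h]
  · rw [star_trivial]
    exact (hK.hasSum_quadForm x v).nonneg fun l =>
      mul_nonneg (by positivity) (mul_nonneg (hK.ev_pos l).le (sq_nonneg _))

/-- The matrix of the first `k` eigenfunctions at the design points. -/
def featureMatrix (φ : ℕ → 𝒳 → ℝ) (k : ℕ) (x : Fin n → 𝒳) : Matrix (Fin n) (Fin k) ℝ :=
  Matrix.of fun i l => φ l (x i)

/-- Keep the terms `l < k` of the series; each has `ev l ≥ ev k`. -/
theorem IsMercerExpansion.featureMatrix_le_quadForm (hK : IsMercerExpansion PX K ev φ) (k : ℕ)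
    (x : Fin n → 𝒳) (v : Fin n → ℝ) :
    ev k / n * (((featureMatrix φ k x)ᵀ *ᵥ v) ⬝ᵥ ((featureMatrix φ k x)ᵀ *ᵥ v))
      ≤ v ⬝ᵥ kernelMatrix K x *ᵥ v := by
  have h := sum_le_hasSum (Finset.range k) (fun l _ => mul_nonneg (inv_nonneg.2 (Nat.cast_nonneg n))
    (mul_nonneg (hK.ev_pos l).le (sq_nonneg _))) (hK.hasSum_quadForm x v)
  refine le_trans ?_ h
  rw [Finset.sum_range, dotProduct, Finset.mul_sum]
  refine Finset.sum_le_sum fun l _ => ?_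
  have h1 : ((featureMatrix φ k x)ᵀ *ᵥ v) l = ∑ i, v i * φ l (x i) := by
    simp only [featureMatrix, Matrix.mulVec, dotProduct, Matrix.transpose_apply, Matrix.of_apply]
    exact Finset.sum_congr rfl fun i _ => mul_comm _ _
  rw [h1, ← pow_two, div_eq_inv_mul, mul_assoc]
  gcongr
  exact hK.ev_antitone l.2.le

/-- The empirical inner products of the eigenfunctions are close to the population ones. -/
def IsNearlyOrthonormal (φ : ℕ → 𝒳 → ℝ) (k : ℕ) (x : Fin n → 𝒳) : Prop :=
  ∀ a b : Fin k, |(∑ i, φ a (x i) * φ b (x i)) / n - if a = b then 1 else 0| ≤ 1 / (2 * k)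

/-- Near orthonormality gives `ΦᵀΦ ≥ n/2`, and the kernel matrix dominates `(ev k / n) ΦΦᵀ`; the
product of the two constants is `ev k / 2`. -/
theorem IsMercerExpansion.le_card_eigenvalues (hK : IsMercerExpansion PX K ev φ) {k : ℕ}
    (hn : 0 < n) {x : Fin n → 𝒳} (hx : IsNearlyOrthonormal φ k x) {lam : ℝ}
    (hlam : lam < ev k / 2) (U : Matrix (Fin n) (Fin n) ℝ)
    (hU : U ∈ Matrix.orthogonalGroup (Fin n) ℝ) (d : Fin n → ℝ)
    (hAd : kernelMatrix K x = U * Matrix.diagonal d * Uᵀ) :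
    k ≤ (Finset.univ.filter fun j => lam < d j).card := by
  have hn' : (0 : ℝ) < n := Nat.cast_pos.2 hn
  refine le_card_eigenvalues_gt (m := ev k / n) (h := n / 2) (div_pos (hK.ev_pos k) hn')
    (by positivity) (hK.featureMatrix_le_quadForm k x) (fun a => ?_) ?_ U hU d hAd
  · set Φ := featureMatrix φ k x
    have h := half_dotProduct_le_of_entries (G := (n : ℝ)⁻¹ • (Φᵀ * Φ)) (fun p q => by
      convert! hx p q using 3
      rw [Matrix.smul_apply, Matrix.mul_apply, smul_eq_mul, div_eq_inv_mul]
      rfl) a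
    rw [Matrix.smul_mulVec, dotProduct_smul, ← Matrix.mulVec_mulVec, Matrix.dotProduct_mulVec a,
      Matrix.vecMul_transpose, smul_eq_mul, inv_mul_eq_div, le_div_iff₀ hn'] at h
    linarith
  · rw [div_mul_div_comm, mul_comm (ev k), mul_div_mul_left _ _ hn'.ne']
    exact hlam

/-- The strong law for each of the `k²` products of eigenfunctions, and a union bound. -/
theorem IsMercerExpansion.tendsto_not_isNearlyOrthonormal (hK : IsMercerExpansion PX K ev φ)
    {Ω : Type*} [MeasurableSpace Ω] {P : Measure Ω} [IsProbabilityMeasure P] {x : ℕ → Ω → 𝒳}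
    (hx : ∀ i, Measurable (x i)) (hindep : iIndepFun x P) (hlaw : ∀ i, P.map (x i) = PX) (k : ℕ) :
    Tendsto (fun n => P {ω | ¬ IsNearlyOrthonormal φ k fun i : Fin n => x i ω}) atTop (𝓝 0) := by
  -- At `k = 0` the tolerance `1/(2k)` reads as `0`, which is not an admissible distance for
  -- convergence in measure; the event is then empty.
  rcases Nat.eq_zero_or_pos k with rfl | hk
  · have : ∀ n, {ω | ¬ IsNearlyOrthonormal φ 0 fun i : Fin n => x i ω} = ∅ := fun n =>
      Set.eq_empty_of_forall_notMem fun ω h => h fun a => a.elim0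
    simp [this]
  have hmeas : ∀ a b, Measurable fun z => φ a z * φ b z := fun a b =>
    (hK.measurable a).mul (hK.measurable b)
  have hentry : ∀ a b : Fin k, Tendsto (fun n => P {ω | 1 / (2 * (k : ℝ)) ≤
      dist ((∑ i : Fin n, φ a (x i ω) * φ b (x i ω)) / n) (if a = b then 1 else 0)}) atTop (𝓝 0) := by
    intro a b
    have hint : Integrable (fun z => φ a z * φ b z) PX :=
      (hK.memLp a).integrable_mul (hK.memLp b)
    have hlln := strong_law_ae_real (μ := P) (fun i ω => φ a (x i ω) * φ b (x i ω))
      (by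
        rw [← hlaw 0] at hint
        exact hint.comp_measurable (hx 0))
      (fun i j hij => (hindep.indepFun hij).comp (hmeas a b) (hmeas a b))
      (fun i => (IdentDistrib.mk (hx i).aemeasurable (hx 0).aemeasurable
        (by rw [hlaw, hlaw])).comp (hmeas a b))
    have hmean : ∫ ω, φ a (x 0 ω) * φ b (x 0 ω) ∂P = if a = b then 1 else 0 := by
      rw [← integral_map (f := fun z => φ a z * φ b z) (hx 0).aemeasurable
        (hmeas a b).aestronglyMeasurable, hlaw, hK.orthonormal]
      simp [Fin.ext_iff]
    simp only [hmean, Finset.sum_range] at hlln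
    have hterm : ∀ i, Measurable fun ω => φ a (x i ω) * φ b (x i ω) := fun i =>
      (hmeas a b).comp (hx i)
    have hmean_meas : ∀ n : ℕ, AEStronglyMeasurable
        (fun ω => (∑ i : Fin n, φ a (x i ω) * φ b (x i ω)) / (n : ℝ)) P := fun n =>
      ((Finset.measurable_sum Finset.univ fun (i : Fin n) _ => hterm i).div_const
        (n : ℝ)).aestronglyMeasurable
    have hm := tendstoInMeasure_of_tendsto_ae hmean_meas hlln
    rw [tendstoInMeasure_iff_dist] at hm
    exact hm _ (by positivity)
  have hsum := tendsto_finsetSum Finset.univ fun a (_ : a ∈ Finset.univ) =>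
    tendsto_finsetSum Finset.univ fun b (_ : b ∈ Finset.univ) => hentry a b
  simp only [Finset.sum_const_zero] at hsum
  refine tendsto_of_tendsto_of_tendsto_of_le_of_le tendsto_const_nhds hsum (fun _ => zero_le)
    fun n => ?_
  have hsub : {ω | ¬ IsNearlyOrthonormal φ k fun i : Fin n => x i ω} ⊆ ⋃ a : Fin k, ⋃ b : Fin k,
      {ω | 1 / (2 * (k : ℝ)) ≤
        dist ((∑ i : Fin n, φ a (x i ω) * φ b (x i ω)) / n) (if a = b then 1 else 0)} := by
    intro ω hω
    simp only [IsNearlyOrthonormal, Set.mem_ofPred_eq, not_forall, not_le] at hω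
    obtain ⟨a, b, h⟩ := hω
    simp only [Set.mem_iUnion, Set.mem_ofPred_eq, Real.dist_eq]
    exact ⟨a, b, h.le⟩
  refine (measure_mono hsub).trans ((measure_iUnion_fintype_le _ _).trans ?_)
  exact Finset.sum_le_sum fun a _ => measure_iUnion_fintype_le _ _

/-- The number of population eigenvalues greater than `λ` tends to infinity as `λ → 0`. -/
theorem tendsto_popDim (hK : IsMercerExpansion PX K ev φ) (hs : Summable ev) {lam : ℕ → ℝ}
    (hpos : ∀ n, 0 < lam n) (hlam : Tendsto lam atTop (𝓝 0)) :
    Tendsto (fun n => popDim ev (lam n)) atTop atTop := by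
  refine tendsto_atTop.2 fun k => ?_
  filter_upwards [hlam.eventually_lt_const (hK.ev_pos k)] with n hn
  -- `Set.ncard` is `0` on infinite sets, so finiteness is needed before comparing cardinalities.
  have hfin : {i | lam n < ev i}.Finite := by
    have := hs.tendsto_atTop_zero.eventually_lt_const (hpos n)
    obtain ⟨N, hN⟩ := eventually_atTop.1 this
    refine (Set.finite_Iio N).subset fun i hi => ?_
    by_contra h
    exact (lt_asymm hi (hN i (not_lt.1 h)))
  have hsub : (Finset.range k : Set ℕ) ⊆ {i | lam n < ev i} := fun i hi =>
    hn.trans_le (hK.ev_antitone (Finset.mem_range.1 hi).le)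
  have := Set.ncard_le_ncard hsub hfin
  rwa [Set.ncard_coe_finset, Finset.card_range] at this

end Mercer

/-! ### The satisfiability event -/

theorem expNeg_le_exp {a : ℝ≥0∞} {r : NNReal} (hr : (r : ℝ≥0∞) ≤ a) (m : ℕ) :
    expNeg (a * m) ≤ Real.exp (-(r * m)) := by
  rw [expNeg]
  split_ifs with h
  · exact (Real.exp_pos _).le
  · refine Real.exp_le_exp.2 (neg_le_neg ?_)
    have h1 : ((r * m : NNReal) : ℝ≥0∞) ≤ a * m := by push_cast; gcongr
    have := ENNReal.toReal_mono h h1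
    simpa using this

theorem expNeg_nonneg (a : ℝ≥0∞) : 0 ≤ expNeg a := by
  rw [expNeg]; split_ifs <;> positivity

theorem expNeg_lt_one {a : ℝ≥0∞} (ha : 0 < a) : expNeg a < 1 := by
  rw [expNeg]
  split_ifs with h
  · exact one_pos
  · exact Real.exp_lt_one_iff.2 (neg_neg_of_pos (ENNReal.toReal_pos ha.ne' h))

theorem tendsto_expNeg_mul {a : ℝ≥0∞} (ha : 0 < a) {m : ℕ → ℕ} (hm : Tendsto m atTop atTop) :
    Tendsto (fun n => expNeg (a * m n)) atTop (𝓝 0) := by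
  obtain ⟨r, hr0, hr⟩ := ENNReal.lt_iff_exists_nnreal_btwn.1 ha
  have hr0' : (0 : ℝ) < r := by exact_mod_cast hr0
  have h : Tendsto (fun n => Real.exp (-(r * (m n : ℝ)))) atTop (𝓝 0) :=
    Real.tendsto_exp_neg_atTop_nhds_zero.comp
      ((tendsto_natCast_atTop_atTop.comp hm).const_mul_atTop hr0')
  exact squeeze_zero (fun n => expNeg_nonneg _) (fun n => expNeg_le_exp hr.le _) h

/-- Markov's inequality for the conditional probability, whose mean is `P(E)`. -/
theorem IsOfType.nullMeasurableSet_and_le {Ω 𝒵 : Type*} [MeasurableSpace Ω] [MeasurableSpace 𝒵]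
    {P : Measure Ω} [IsProbabilityMeasure P] {X : Ω → 𝒵} (hX : Measurable X) {a b : ℝ≥0∞}
    (ha : 0 < a) (hb : 0 < b) {E : Set Ω} (h : IsOfType P X a b E) :
    NullMeasurableSet E P ∧ (1 - expNeg a) * (1 - expNeg b) ≤ P.real E := by
  have ha1 := expNeg_lt_one ha
  have hb1 := expNeg_lt_one hb
  set f : Ω → ℝ := E.indicator fun _ => 1 with hf
  -- Measurability of `E` is forced: otherwise the conditional expectation is `0` by convention and
  -- never reaches `1 - exp(-a) > 0`.
  have hint : Integrable f P := by
    by_contra hni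
    rw [IsOfType, condExp_of_not_integrable hni] at h
    have : {ω : Ω | 1 - expNeg a ≤ (0 : Ω → ℝ) ω} = ∅ :=
      Set.eq_empty_of_forall_notMem fun ω hω => by
        have : 1 - expNeg a ≤ 0 := hω
        linarith
    rw [this, measureReal_empty] at h
    linarith
  have hE : NullMeasurableSet E P := (aemeasurable_indicator_const_iff (1 : ℝ)).1 hint.aemeasurable
  refine ⟨hE, ?_⟩
  have hm := hX.comap_le
  have hfnn : 0 ≤ᵐ[P] f := .of_forall fun ω => Set.indicator_nonneg (fun _ _ => zero_le_one) ω
  have hcnn := condExp_nonneg (m := MeasurableSpace.comap X inferInstance) hfnn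
  have hI : ∫ ω, (P[f | MeasurableSpace.comap X inferInstance]) ω ∂P = P.real E := by
    rw [integral_condExp hm, hf, integral_indicator₀ hE]; simp
  rw [← hI]
  refine le_trans ?_ (mul_meas_ge_le_integral_of_nonneg hcnn integrable_condExp (1 - expNeg a))
  exact mul_le_mul_of_nonneg_left h (by linarith)

theorem tendsto_measure_compl_of_isOfType {Ω : Type*} [MeasurableSpace Ω] {P : Measure Ω}
    [IsProbabilityMeasure P] {𝒵 : ℕ → Type*} [∀ n, MeasurableSpace (𝒵 n)] {X : ∀ n, Ω → 𝒵 n}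
    (hX : ∀ n, Measurable (X n)) {c₁ c₂ : ℝ≥0∞} (hc₁ : 0 < c₁) (hc₂ : 0 < c₂) {s p : ℕ → ℕ}
    (hs : Tendsto s atTop atTop) (hp : Tendsto p atTop atTop) {E : ℕ → Set Ω}
    (hE : ∀ᶠ n in atTop, IsOfType P (X n) (c₁ * s n) (c₂ * p n) (E n)) :
    Tendsto (fun n => P (E n)ᶜ) atTop (𝓝 0) := by
  have h1 := (tendsto_const_nhds (x := (1 : ℝ))).sub (tendsto_expNeg_mul hc₁ hs)
  have h2 := (tendsto_const_nhds (x := (1 : ℝ))).sub (tendsto_expNeg_mul hc₂ hp)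
  have h3 := (tendsto_const_nhds (x := (1 : ℝ))).sub (h1.mul h2)
  have h4 := ENNReal.tendsto_ofReal h3
  simp only [sub_zero, mul_one, sub_self, ENNReal.ofReal_zero] at h4
  refine tendsto_of_tendsto_of_tendsto_of_le_of_le' tendsto_const_nhds h4
    (.of_forall fun _ => zero_le) ?_
  filter_upwards [hE, hs.eventually_gt_atTop 0, hp.eventually_gt_atTop 0] with n hn hsn hpn
  have ha : 0 < c₁ * s n := ENNReal.mul_pos hc₁.ne' (by exact_mod_cast hsn.ne')
  have hb : 0 < c₂ * p n := ENNReal.mul_pos hc₂.ne' (by exact_mod_cast hpn.ne')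
  obtain ⟨hnull, hle⟩ := hn.nullMeasurableSet_and_le (hX n) ha hb
  rw [← ofReal_measureReal, measureReal_compl₀ hnull, probReal_univ]
  exact ENNReal.ofReal_le_ofReal (by linarith)

end SketchedKRR

/-! ### Functions of an independent pair -/

section IndependentPair

variable {Ω 𝒵 𝒴 : Type*} [mΩ : MeasurableSpace Ω] [mZ : MeasurableSpace 𝒵] [MeasurableSpace 𝒴]
  {P : Measure Ω} [IsProbabilityMeasure P] {Z : Ω → 𝒵} {Y : Ω → 𝒴} {ν : Measure 𝒴}

theorem ProbabilityTheory.IndepFun.map_prodMk_eq (hZ : Measurable Z) (hY : Measurable Y)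
    (hind : IndepFun Y Z P) (hν : P.map Y = ν) :
    P.map (fun ω => (Z ω, Y ω)) = (P.map Z).prod ν := by
  rw [← hν]
  exact (indepFun_iff_map_prod_eq_prod_map_map hZ.aemeasurable hY.aemeasurable).1 hind.symm

/-- The integral of a function of an independent pair, computed by integrating out one variable. -/
theorem ProbabilityTheory.IndepFun.integral_comp_eq {E : Type*} [NormedAddCommGroup E]
    [NormedSpace ℝ E] [SFinite ν] (hZ : Measurable Z) (hY : Measurable Y) (hind : IndepFun Y Z P)
    (hν : P.map Y = ν) {F : 𝒵 × 𝒴 → E} (hF : StronglyMeasurable F)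
    (hint : Integrable (fun ω => F (Z ω, Y ω)) P) {t : Set 𝒵} (ht : MeasurableSet t) :
    ∫ ω in Z ⁻¹' t, F (Z ω, Y ω) ∂P = ∫ ω in Z ⁻¹' t, ∫ y, F (Z ω, y) ∂ν ∂P := by
  have hmap := hind.map_prodMk_eq hZ hY hν
  have hZY : Measurable fun ω => (Z ω, Y ω) := hZ.prodMk hY
  have hint' : Integrable F ((P.map Z).prod ν) := by
    rw [← hmap, integrable_map_measure hF.aestronglyMeasurable hZY.aemeasurable]
    exact hint
  have hpre : Z ⁻¹' t = (fun ω => (Z ω, Y ω)) ⁻¹' (t ×ˢ Set.univ) := by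
    ext ω; simp
  nth_rw 1 [hpre]
  rw [← setIntegral_map (ht.prod MeasurableSet.univ) hF.aestronglyMeasurable hZY.aemeasurable, hmap,
    setIntegral_prod _ hint'.integrableOn, Measure.restrict_univ,
    setIntegral_map ht (hF.integral_prod_right').aestronglyMeasurable hZ.aemeasurable]

/-- The conditional expectation of a function of an independent pair given one of the variables. -/
theorem ProbabilityTheory.IndepFun.condExp_comp_eq {E : Type*} [NormedAddCommGroup E]
    [NormedSpace ℝ E] [CompleteSpace E] [SFinite ν] (hZ : Measurable Z) (hY : Measurable Y)
    (hind : IndepFun Y Z P)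
    (hν : P.map Y = ν) {F : 𝒵 × 𝒴 → E} (hF : StronglyMeasurable F)
    (hint : Integrable (fun ω => F (Z ω, Y ω)) P) :
    P[fun ω => F (Z ω, Y ω) | MeasurableSpace.comap Z mZ] =ᵐ[P] fun ω => ∫ y, F (Z ω, y) ∂ν := by
  have hmap := hind.map_prodMk_eq hZ hY hν
  have hint' : Integrable F ((P.map Z).prod ν) := by
    rw [← hmap, integrable_map_measure hF.aestronglyMeasurable (hZ.prodMk hY).aemeasurable]
    exact hint
  have hintZ : Integrable (fun ω => ∫ y, F (Z ω, y) ∂ν) P := by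
    have h := hint'.integral_prod_left
    rw [integrable_map_measure hF.integral_prod_right'.aestronglyMeasurable hZ.aemeasurable] at h
    exact h
  refine (ae_eq_condExp_of_forall_setIntegral_eq hZ.comap_le hint
    (fun s _ _ => hintZ.integrableOn) ?_ ?_).symm
  · rintro s ⟨t, ht, rfl⟩ -
    exact (hind.integral_comp_eq hZ hY hν hF hint ht).symm
  · exact (hF.integral_prod_right'.comp_measurable
      (comap_measurable Z)).aestronglyMeasurable

/-- The mean of a bounded function that is small off an event. -/
theorem norm_integral_le_add_measure {F : Ω → ℂ} {B : Set Ω} {η : ℝ} (hη : 0 ≤ η)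
    (hF : ∀ ω, ‖F ω‖ ≤ 2) (hB : ∀ ω ∉ B, ‖F ω‖ ≤ η) : ‖∫ ω, F ω ∂P‖ ≤ η + 2 * P.real B := by
  -- `B` need not be measurable, so it is enlarged to a measurable set of the same measure.
  have hm := measurableSet_toMeasurable P B
  have hint : Integrable (fun ω => η + (toMeasurable P B).indicator (fun _ => (2 : ℝ)) ω) P :=
    (integrable_const _).add ((integrable_const _).indicator hm)
  refine (norm_integral_le_of_norm_le hint (.of_forall fun ω => ?_)).trans_eq ?_
  · by_cases h : ω ∈ toMeasurable P B
    · rw [Set.indicator_of_mem h]; linarith [hF ω]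
    · rw [Set.indicator_of_notMem h, add_zero]
      exact hB ω fun h' => h (subset_toMeasurable P B h')
  · rw [integral_add (integrable_const _) ((integrable_const _).indicator hm),
      integral_indicator hm]
    simp [Measure.real, mul_comm]

end IndependentPair

/-- A mixed central limit theorem: a function of an independent pair is asymptotically standard
normal when its conditional characteristic functions given one variable converge in probability. -/
theorem tendstoInDistribution_gaussianReal_of_conditional_charFun {Ω : Type*} [MeasurableSpace Ω]
    {P : Measure Ω} [IsProbabilityMeasure P] {𝒵 𝒴 : ℕ → Type*} [∀ n, MeasurableSpace (𝒵 n)]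
    [∀ n, MeasurableSpace (𝒴 n)] {Z : ∀ n, Ω → 𝒵 n} {Y : ∀ n, Ω → 𝒴 n}
    {ν : ∀ n, Measure (𝒴 n)} [∀ n, IsProbabilityMeasure (ν n)] (hZ : ∀ n, Measurable (Z n))
    (hY : ∀ n, Measurable (Y n)) (hind : ∀ n, IndepFun (Y n) (Z n) P)
    (hν : ∀ n, P.map (Y n) = ν n) {h : ∀ n, 𝒵 n → 𝒴 n → ℝ}
    (hh : ∀ n, Measurable fun p : 𝒵 n × 𝒴 n => h n p.1 p.2) {W : ℕ → Ω → ℝ}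
    (hW : ∀ n, Measurable (W n))
    (hconv : ∀ t : ℝ, ∀ η > 0, ∃ B : ℕ → Set Ω, Tendsto (fun n => P (B n)) atTop (𝓝 0) ∧
      ∀ n, ∀ ω ∉ B n, W n ω = h n (Z n ω) (Y n ω) ∧
        ‖∫ y, Complex.exp (t * (h n (Z n ω) y : ℂ) * Complex.I) ∂ν n
          - Complex.exp ((-(t ^ 2 / 2) : ℝ) : ℂ)‖ ≤ η) :
    TendstoInDistribution W atTop (id : ℝ → ℝ) (fun _ => P) (gaussianReal 0 1) where
  forall_aemeasurable n := (hW n).aemeasurable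
  aemeasurable_limit := aemeasurable_id
  tendsto := by
    refine ProbabilityMeasure.tendsto_iff_tendsto_charFun.2 fun t => ?_
    simp only [ProbabilityMeasure.coe_mk, Measure.map_id, charFun_gaussianReal]
    have hlim : Complex.exp (t * (0 : ℝ) * Complex.I - ((1 : NNReal) : ℝ) * t ^ 2 / 2)
        = Complex.exp ((-(t ^ 2 / 2) : ℝ) : ℂ) := by
      congr 1; push_cast; ring
    rw [hlim, Metric.tendsto_atTop']
    set c := Complex.exp ((-(t ^ 2 / 2) : ℝ) : ℂ) with hc
    have hc1 : ‖c‖ ≤ 1 := by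
      rw [hc, Complex.norm_exp_ofReal]
      exact Real.exp_le_one_iff.2 (by nlinarith [sq_nonneg t])
    intro r hr
    obtain ⟨B, hB0, hB⟩ := hconv t (r / 4) (by positivity)
    have hB1 : Tendsto (fun n => P.real (B n)) atTop (𝓝 0) := by
      exact (ENNReal.tendsto_toReal ENNReal.zero_ne_top).comp hB0
    obtain ⟨N, hN⟩ := eventually_atTop.1 (hB1.eventually_lt_const (show (0 : ℝ) < r / 8 by positivity))
    refine ⟨N, fun n hn => ?_⟩
    have hBn := hN n hn.le
    have hbd : ∀ x : ℝ, ‖Complex.exp (t * (x : ℂ) * Complex.I)‖ = 1 := fun x => by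
      rw [← Complex.ofReal_mul, Complex.norm_exp_ofReal_mul_I]
    set F : 𝒵 n × 𝒴 n → ℂ := fun p => Complex.exp (t * (h n p.1 p.2 : ℂ) * Complex.I) with hF
    have hFm : Measurable F := by
      have := hh n
      fun_prop
    have hYZ : Measurable fun ω => (Z n ω, Y n ω) := (hZ n).prodMk (hY n)
    have hFi : Integrable (fun ω => F (Z n ω, Y n ω)) P :=
      Integrable.of_bound (hFm.comp hYZ).aestronglyMeasurable 1 (.of_forall fun ω => (hbd _).le)
    have hWi : Integrable (fun ω => Complex.exp (t * (W n ω : ℂ) * Complex.I)) P := by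
      refine Integrable.of_bound ?_ 1 (.of_forall fun ω => (hbd _).le)
      have := hW n
      exact Measurable.aestronglyMeasurable (by fun_prop)
    have hG : StronglyMeasurable fun z : 𝒵 n => ∫ y, F (z, y) ∂ν n :=
      hFm.stronglyMeasurable.integral_prod_right'
    have hGb : ∀ z, ‖∫ y, F (z, y) ∂ν n‖ ≤ 1 := fun z => by
      refine (norm_integral_le_of_norm_le_const (C := 1) (.of_forall fun y => (hbd _).le)).trans ?_
      simp
    have hGi : Integrable (fun ω => ∫ y, F (Z n ω, y) ∂ν n) P :=
      Integrable.of_bound (hG.comp_measurable (hZ n)).aestronglyMeasurable 1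
        (.of_forall fun ω => hGb _)
    have h1 := (hind n).integral_comp_eq (hZ n) (hY n) (hν n) hFm.stronglyMeasurable hFi
      MeasurableSet.univ
    simp only [Set.preimage_univ, Measure.restrict_univ] at h1
    have h2 : ‖∫ ω, (Complex.exp (t * (W n ω : ℂ) * Complex.I) - F (Z n ω, Y n ω)) ∂P‖
        ≤ 0 + 2 * P.real (B n) := by
      refine norm_integral_le_add_measure le_rfl (fun ω => ?_) fun ω hω => ?_
      · refine (norm_sub_le _ _).trans ?_
        rw [hbd, hF, hbd]; norm_num
      · rw [(hB n ω hω).1, hF, sub_self, norm_zero]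
    have h3 : ‖∫ ω, ((∫ y, F (Z n ω, y) ∂ν n) - c) ∂P‖ ≤ r / 4 + 2 * P.real (B n) := by
      refine norm_integral_le_add_measure (by positivity) (fun ω => ?_) fun ω hω => (hB n ω hω).2
      exact (norm_sub_le _ _).trans (by linarith [hGb (Z n ω)])
    rw [integral_sub hWi hFi, h1] at h2
    rw [integral_sub hGi (integrable_const _)] at h3
    simp only [integral_const, probReal_univ, one_smul] at h3
    rw [charFun_apply_real, integral_map (hW n).aemeasurable (by fun_prop), dist_eq_norm]
    calc _ ≤ _ + _ := norm_sub_le_norm_sub_add_norm_sub _ _ _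
      _ < r := by linarith

namespace SketchedKRR

theorem MeasurableEntries.comp {Z Z' m n : Type*} [MeasurableSpace Z] [MeasurableSpace Z']
    {M : Z → Matrix m n ℝ} (hM : MeasurableEntries M) {g : Z' → Z} (hg : Measurable g) :
    MeasurableEntries fun z => M (g z) :=
  fun i j => (hM i j).comp hg

theorem MeasurableEntries.measurable_quadForm {Z ι : Type*} [MeasurableSpace Z] [Fintype ι]
    {R : Z → Matrix ι ι ℝ} (hR : MeasurableEntries R) {e : Z → ι → ℝ} (he : Measurable e) :
    Measurable fun z => e z ⬝ᵥ R z *ᵥ e z := by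
  have he' : ∀ i, Measurable fun z => e z i := fun i => (measurable_pi_apply i).comp he
  simp only [dotProduct, Matrix.mulVec]
  exact Finset.measurable_sum _ fun i _ => (he' i).mul
    (Finset.measurable_sum _ fun j _ => (hR i j).mul (he' j))

/-! ### Measurability of the statistic and of the well-posed event -/

section Statistic

variable {d n s : ℕ} {𝒳 : Set (EuclideanSpace ℝ (Fin d))} {PX : Measure 𝒳} {K : 𝒳 → 𝒳 → ℝ}
  {ev : ℕ → ℝ} {φ : ℕ → 𝒳 → ℝ}

theorem IsMercerExpansion.measurableEntries_smoother (hK : IsMercerExpansion PX K ev φ) (lam : ℝ) :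
    MeasurableEntries fun z : (Fin n → 𝒳) × (Fin s → Fin n → ℝ) =>
      smoother (kernelMatrix K z.1) (Matrix.of z.2) lam :=
  (hK.measurableEntries_kernelMatrix measurable_fst).smoother (fun i j => by
    simp only [Matrix.of_apply]; fun_prop) lam

theorem IsMercerExpansion.measurableEntries_sandwich (hK : IsMercerExpansion PX K ev φ) (lam : ℝ)
    (k : ℕ) :
    MeasurableEntries fun z : (Fin n → 𝒳) × (Fin s → Fin n → ℝ) => (1 - hat z.1) *
      smoother (kernelMatrix K z.1) (Matrix.of z.2) lam ^ k * (1 - hat z.1) :=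
  have hQ : MeasurableEntries fun z : (Fin n → 𝒳) × (Fin s → Fin n → ℝ) => 1 - hat z.1 :=
    (MeasurableEntries.const 1).sub (measurableEntries_hat measurable_fst)
  (hQ.mul ((hK.measurableEntries_smoother lam).pow k)).mul hQ

theorem IsMercerExpansion.measurableEntries_residualMatrix (hK : IsMercerExpansion PX K ev φ)
    (lam : ℝ) :
    MeasurableEntries fun z : (Fin n → 𝒳) × (Fin s → Fin n → ℝ) =>
      residualMatrix K z.1 (Matrix.of z.2) lam :=
  hK.measurableEntries_sandwich lam 2

theorem IsMercerExpansion.measurable_linStat (hK : IsMercerExpansion PX K ev φ) {lam : ℝ}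
    (hlam : 0 < lam) {Ω : Type*} [MeasurableSpace Ω] {x : Ω → Fin n → 𝒳}
    {S : Ω → Fin s → Fin n → ℝ} {y : Ω → Fin n → ℝ} (hx : Measurable x) (hS : Measurable S)
    (hy : Measurable y) : Measurable fun ω => linStat K (x ω) (Matrix.of (S ω)) lam (y ω) := by
  have h := ((hK.measurableEntries_residualMatrix lam).comp
    (hx.prodMk hS)).measurable_quadForm hy
  simp only [linStat_eq (hK.kernelMatrix_posSemidef _) hlam]
  exact h.div_const (n : ℝ)

theorem IsMercerExpansion.measurableSet_isWellPosed (hK : IsMercerExpansion PX K ev φ) (lam : ℝ) :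
    MeasurableSet {z : (Fin n → 𝒳) × (Fin s → Fin n → ℝ) |
      IsWellPosed K z.1 (Matrix.of z.2) lam} := by
  have h1 : MeasurableEntries fun z : (Fin n → 𝒳) × (Fin s → Fin n → ℝ) => design z.1 :=
    measurableEntries_design measurable_fst
  have h2 : MeasurableEntries fun z : (Fin n → 𝒳) × (Fin s → Fin n → ℝ) =>
      gramMatrix (kernelMatrix K z.1) (Matrix.of z.2) lam :=
    (hK.measurableEntries_kernelMatrix measurable_fst).gramMatrix (fun i j => by
      simp only [Matrix.of_apply]; fun_prop) lam
  simp only [IsWellPosed, isUnit_iff_ne_zero]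
  exact ((h1.mul h1.transpose).det (measurableSet_singleton 0).compl).inter
    (h2.det (measurableSet_singleton 0).compl)

theorem IsLinearFun.measurable {f : 𝒳 → ℝ} (hf : IsLinearFun f) : Measurable f := by
  obtain ⟨b0, b1, hb⟩ := hf
  have hm : Measurable fun x : 𝒳 => b0 + ∑ j, b1 j * (x : EuclideanSpace ℝ (Fin d)) j := by
    have h : Measurable fun x : 𝒳 => (x : EuclideanSpace ℝ (Fin d)) := measurable_subtype_coe
    fun_prop
  exact (funext hb : f = _) ▸ hm

end Statistic

/-! ### Conditional moments of random quadratic forms -/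

section ConditionalMoments

variable {n : ℕ}

theorem quadForm_mem_Icc {R : Matrix (Fin n) (Fin n) ℝ} (hR : R.PosSemidef)
    (hR1 : (1 - R).PosSemidef) (e : Fin n → ℝ) : e ⬝ᵥ R *ᵥ e ∈ Set.Icc 0 (e ⬝ᵥ e) := by
  have h1 := hR.dotProduct_mulVec_nonneg e
  have h2 := hR1.dotProduct_mulVec_nonneg e
  rw [star_trivial] at h1 h2
  rw [Matrix.sub_mulVec, Matrix.one_mulVec, dotProduct_sub] at h2
  exact ⟨h1, by linarith⟩

theorem trace_mem_Icc {R : Matrix (Fin n) (Fin n) ℝ} (hR : R.PosSemidef)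
    (hR1 : (1 - R).PosSemidef) : R.trace ∈ Set.Icc 0 (n : ℝ) := by
  have h1 := hR.trace_nonneg
  have h2 := hR1.trace_nonneg
  rw [Matrix.trace_sub, Matrix.trace_one, Fintype.card_fin] at h2
  exact ⟨h1, by linarith⟩

theorem memLp_dotProduct_self_gaussianPi (n : ℕ) :
    MemLp (fun e : Fin n → ℝ => e ⬝ᵥ e) 2 (gaussianPi (Fin n)) := by
  have h := (memLp_sum_mul_sq_sub_one (fun _ : Fin n => (1 : ℝ))).add
    (memLp_const (μ := gaussianPi (Fin n)) (p := 2) (n : ℝ))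
  refine h.ae_eq (.of_forall fun e => ?_)
  simp [dotProduct, pow_two]

variable {Ω 𝒵 : Type*} [MeasurableSpace Ω] [mZ : MeasurableSpace 𝒵] {P : Measure Ω}
  [IsProbabilityMeasure P] {Z : Ω → 𝒵} {Y : Ω → Fin n → ℝ} {G : Set 𝒵}
  {R : 𝒵 → Matrix (Fin n) (Fin n) ℝ}

/-- The conditional mean of a random quadratic form in independent standard normal noise. -/
theorem condExp_indicator_quadForm (hZ : Measurable Z) (hY : Measurable Y) (hind : IndepFun Y Z P)
    (hlaw : P.map Y = gaussianPi (Fin n)) (hG : MeasurableSet G) (hRm : MeasurableEntries R)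
    (hR : ∀ z ∈ G, (R z).PosSemidef) (hR1 : ∀ z ∈ G, (1 - R z).PosSemidef) :
    P[(Z ⁻¹' G).indicator fun ω => (Y ω ⬝ᵥ R (Z ω) *ᵥ Y ω) / n | MeasurableSpace.comap Z mZ]
      =ᵐ[P] (Z ⁻¹' G).indicator fun ω => (R (Z ω)).trace / n := by
  classical
  set F : 𝒵 × (Fin n → ℝ) → ℝ :=
    (G ×ˢ Set.univ).indicator fun p => (p.2 ⬝ᵥ R p.1 *ᵥ p.2) / n with hF
  have hFm : Measurable F := by
    refine Measurable.indicator ?_ (hG.prod MeasurableSet.univ)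
    exact (MeasurableEntries.measurable_quadForm (R := fun p : 𝒵 × (Fin n → ℝ) => R p.1)
      (hRm.comp measurable_fst) measurable_snd).div_const _
  have hFe : ∀ z e, F (z, e) = if z ∈ G then (e ⬝ᵥ R z *ᵥ e) / n else 0 := fun z e => by
    simp [hF, Set.indicator_apply]
  have hYY : Integrable (fun ω => (Y ω ⬝ᵥ Y ω) / n) P := by
    have h := ((memLp_dotProduct_self_gaussianPi n).integrable one_le_two).div_const (n : ℝ)
    rw [← hlaw] at h
    exact h.comp_measurable hY
  have hint : Integrable (fun ω => F (Z ω, Y ω)) P := by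
    -- Since `0 ≤ R ≤ I` on `G`, the form is dominated by `|Y|²`, whatever the law of `Z`.
    refine hYY.mono' (hFm.comp (hZ.prodMk hY)).aestronglyMeasurable (.of_forall fun ω => ?_)
    have h0 : 0 ≤ Y ω ⬝ᵥ Y ω := Finset.sum_nonneg fun i _ => mul_self_nonneg _
    rw [hFe]
    split_ifs with h
    · have h1 := quadForm_mem_Icc (hR _ h) (hR1 _ h) (Y ω)
      rw [Real.norm_of_nonneg (div_nonneg h1.1 (Nat.cast_nonneg n))]
      exact div_le_div_of_nonneg_right h1.2 (Nat.cast_nonneg n)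
    · rw [norm_zero]; exact div_nonneg h0 (Nat.cast_nonneg n)
  have h := hind.condExp_comp_eq hZ hY hlaw hFm.stronglyMeasurable hint
  have hl : ((Z ⁻¹' G).indicator fun ω => (Y ω ⬝ᵥ R (Z ω) *ᵥ Y ω) / n)
      = fun ω => F (Z ω, Y ω) := by
    funext ω
    rw [hFe, Set.indicator_apply]
    rfl
  rw [hl]
  refine h.trans (.of_forall fun ω => ?_)
  by_cases h1 : Z ω ∈ G
  · rw [Set.indicator_of_mem (show ω ∈ Z ⁻¹' G from h1)]
    simp only [hFe, if_pos h1]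
    rw [integral_div, integral_quadForm_gaussianPi (hR _ h1).isHermitian]
  · rw [Set.indicator_of_notMem (show ω ∉ Z ⁻¹' G from h1)]
    simp only [hFe, if_neg h1, integral_zero]

/-- The conditional variance of a random quadratic form in independent standard normal noise. -/
theorem condVar_indicator_quadForm (hZ : Measurable Z) (hY : Measurable Y) (hind : IndepFun Y Z P)
    (hlaw : P.map Y = gaussianPi (Fin n)) (hG : MeasurableSet G) (hRm : MeasurableEntries R)
    (hR : ∀ z ∈ G, (R z).PosSemidef) (hR1 : ∀ z ∈ G, (1 - R z).PosSemidef) :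
    Var[(Z ⁻¹' G).indicator fun ω => (Y ω ⬝ᵥ R (Z ω) *ᵥ Y ω) / n; P | MeasurableSpace.comap Z mZ]
      =ᵐ[P] (Z ⁻¹' G).indicator fun ω => 2 * (R (Z ω) ^ 2).trace / n ^ 2 := by
  classical
  set F : 𝒵 × (Fin n → ℝ) → ℝ := (G ×ˢ Set.univ).indicator fun p =>
    (p.2 ⬝ᵥ R p.1 *ᵥ p.2 - (R p.1).trace) ^ 2 / n ^ 2 with hF
  have hFm : Measurable F := by
    refine Measurable.indicator ?_ (hG.prod MeasurableSet.univ)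
    exact (((MeasurableEntries.measurable_quadForm (R := fun p : 𝒵 × (Fin n → ℝ) => R p.1)
      (hRm.comp measurable_fst) measurable_snd).sub
      (hRm.trace.comp measurable_fst)).pow_const 2).div_const _
  have hFe : ∀ z e, F (z, e) = if z ∈ G then (e ⬝ᵥ R z *ᵥ e - (R z).trace) ^ 2 / n ^ 2 else 0 :=
    fun z e => by simp [hF, Set.indicator_apply]
  have hYY : Integrable (fun ω => ((Y ω ⬝ᵥ Y ω) ^ 2 + (n : ℝ) ^ 2) / n ^ 2) P := by
    have h := ((memLp_dotProduct_self_gaussianPi n).integrable_sq.add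
      (integrable_const ((n : ℝ) ^ 2))).div_const ((n : ℝ) ^ 2)
    rw [← hlaw] at h
    exact h.comp_measurable hY
  have hint : Integrable (fun ω => F (Z ω, Y ω)) P := by
    refine hYY.mono' (hFm.comp (hZ.prodMk hY)).aestronglyMeasurable (.of_forall fun ω => ?_)
    rw [hFe]
    split_ifs with h
    · have h1 := quadForm_mem_Icc (hR _ h) (hR1 _ h) (Y ω)
      have h2 := trace_mem_Icc (hR _ h) (hR1 _ h)
      rw [Real.norm_of_nonneg (by positivity)]
      refine div_le_div_of_nonneg_right ?_ (by positivity)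
      have h3 := pow_le_pow_left₀ h1.1 h1.2 2
      have h4 := pow_le_pow_left₀ h2.1 h2.2 2
      -- For nonnegative `q` and `τ`, `(q - τ)² ≤ q² + τ²`.
      have h5 := mul_nonneg h1.1 h2.1
      nlinarith only [h3, h4, h5]
    · rw [norm_zero]; positivity
  have h := hind.condExp_comp_eq hZ hY hlaw hFm.stronglyMeasurable hint
  refine EventuallyEq.trans ?_ (h.trans (.of_forall fun ω => ?_))
  · rw [condVar]
    refine condExp_congr_ae ?_
    -- Inserting the explicit conditional mean makes the squared deviation a function of the pair
    -- `(Z, Y)`.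
    filter_upwards [condExp_indicator_quadForm hZ hY hind hlaw hG hRm hR hR1] with ω hω
    rw [Pi.pow_apply, Pi.sub_apply, hω, hFe]
    by_cases h1 : Z ω ∈ G
    · have h2 : ω ∈ Z ⁻¹' G := h1
      rw [Set.indicator_of_mem h2, Set.indicator_of_mem h2, if_pos h1, ← sub_div, div_pow]
    · have h2 : ω ∉ Z ⁻¹' G := h1
      rw [Set.indicator_of_notMem h2, Set.indicator_of_notMem h2, if_neg h1]
      norm_num
  · by_cases h1 : Z ω ∈ G
    · rw [Set.indicator_of_mem (show ω ∈ Z ⁻¹' G from h1)]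
      simp only [hFe, if_pos h1]
      rw [integral_div, integral_quadForm_sub_trace_sq_gaussianPi (hR _ h1).isHermitian]
    · rw [Set.indicator_of_notMem (show ω ∉ Z ⁻¹' G from h1)]
      simp only [hFe, if_neg h1, integral_zero]

end ConditionalMoments

/-! ### Divergence of the variance and the central limit theorem -/

/-- With probability tending to one the inverses exist and `tr Δ⁴` exceeds any given bound. -/
theorem IsMercerExpansion.tendsto_measure_not_le_trace {d : ℕ}
    {𝒳 : Set (EuclideanSpace ℝ (Fin d))} {PX : Measure 𝒳} {K : 𝒳 → 𝒳 → ℝ} {ev : ℕ → ℝ}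
    {φ : ℕ → 𝒳 → ℝ} (hK : IsMercerExpansion PX K ev φ) (hsum : Summable ev) {lam : ℕ → ℝ}
    (hlam_pos : ∀ n, 0 < lam n) (hlam : Tendsto lam atTop (𝓝 0)) {s : ℕ → ℕ}
    (hs : Tendsto s atTop atTop) {Ω : Type*} [MeasurableSpace Ω] {P : Measure Ω}
    [IsProbabilityMeasure P] {x : ℕ → Ω → 𝒳} (hx : ∀ i, Measurable (x i)) (hx_indep : iIndepFun x P)
    (hx_law : ∀ i, P.map (x i) = PX) {S : ∀ n, Ω → Fin (s n) → Fin n → ℝ}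
    (hS : ∀ n, Measurable (S n)) {c : ℝ}
    {c₁ c₂ : ℝ≥0∞} (hc₁ : 0 < c₁) (hc₂ : 0 < c₂)
    (hsat : ∀ᶠ n in atTop, IsOfType P (fun ω (i : Fin n) => x i ω)
      (c₁ * s n) (c₂ * popDim ev (lam n))
      {ω | IsKSatisfiable c (lam n) (kernelMatrix K fun i : Fin n => x i ω) (Matrix.of (S n ω))})
    (hG : Tendsto (fun n => P {ω | IsWellPosed K (fun i : Fin n => x i ω)
      (Matrix.of (S n ω)) (lam n)}) atTop (𝓝 1)) (L : ℝ) :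
    Tendsto (fun n => P {ω | ¬ (0 < n ∧
      IsWellPosed K (fun i : Fin n => x i ω) (Matrix.of (S n ω)) (lam n) ∧
      L ≤ (smoother (kernelMatrix K fun i : Fin n => x i ω) (Matrix.of (S n ω)) (lam n) ^ 4).trace)})
      atTop (𝓝 0) := by
  have hxn : ∀ n, Measurable fun ω (i : Fin n) => x i ω := fun n =>
    measurable_pi_lambda _ fun i => hx i
  -- Each empirical eigenvalue above `λ` contributes at least `(2 + 4c²)⁻⁴` to `tr Δ⁴`, so a number
  -- `k` independent of `n` suffices.
  obtain ⟨k, hk⟩ := exists_nat_ge (L / (1 / (2 + 4 * c ^ 2)) ^ 4)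
  rw [div_le_iff₀ (by positivity)] at hk
  have hGm : ∀ n, MeasurableSet {ω | IsWellPosed K (fun i : Fin n => x i ω)
      (Matrix.of (S n ω)) (lam n)} := fun n =>
    ((hxn n).prodMk (hS n)) (hK.measurableSet_isWellPosed (lam n))
  have h1 : Tendsto (fun n => P {ω | IsWellPosed K (fun i : Fin n => x i ω)
      (Matrix.of (S n ω)) (lam n)}ᶜ) atTop (𝓝 0) := by
    have h := ENNReal.Tendsto.sub (tendsto_const_nhds (x := (1 : ℝ≥0∞))) hG (.inl ENNReal.one_ne_top)
    rw [tsub_self] at h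
    exact h.congr fun n => (prob_compl_eq_one_sub (hGm n)).symm
  have h2 := tendsto_measure_compl_of_isOfType hxn hc₁ hc₂ hs
    (tendsto_popDim hK hsum hlam_pos hlam) hsat
  have h3 := hK.tendsto_not_isNearlyOrthonormal hx hx_indep hx_law k
  have h4 := (h1.add h2).add h3
  simp only [add_zero] at h4
  refine tendsto_of_tendsto_of_tendsto_of_le_of_le' tendsto_const_nhds h4
    (.of_forall fun _ => zero_le) ?_
  filter_upwards [eventually_gt_atTop 0, hlam.eventually_lt_const (half_pos (hK.ev_pos k))]
    with n hn hln
  refine (measure_mono fun ω hω => ?_).trans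
    ((measure_union_le _ _).trans (add_le_add (measure_union_le _ _) le_rfl))
  by_contra hcon
  simp only [Set.mem_union, Set.mem_compl_iff, Set.mem_ofPred_eq, not_or, not_not] at hcon
  obtain ⟨⟨hw, hE⟩, ho⟩ := hcon
  refine hω ⟨hn, hw, hk.trans ?_⟩
  exact card_le_trace_smoother_pow_four (hK.kernelMatrix_posSemidef _) (hlam_pos n) hw.2 hE
    (hK.le_card_eigenvalues hn ho hln)


/-- Asymptotic normality of a normalized quadratic form in independent standard normal noise, when
its matrix is a contraction and its variance tends to infinity in probability. -/
theorem tendstoInDistribution_normalized_quadForm {Ω : Type*} [MeasurableSpace Ω] {P : Measure Ω}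
    [IsProbabilityMeasure P] {𝒵 : ℕ → Type*} [∀ n, MeasurableSpace (𝒵 n)] {Z : ∀ n, Ω → 𝒵 n}
    {Y : ∀ n, Ω → Fin n → ℝ} (hZ : ∀ n, Measurable (Z n)) (hY : ∀ n, Measurable (Y n))
    (hind : ∀ n, IndepFun (Y n) (Z n) P) (hlaw : ∀ n, P.map (Y n) = gaussianPi (Fin n))
    {R : ∀ n, 𝒵 n → Matrix (Fin n) (Fin n) ℝ} (hRm : ∀ n, MeasurableEntries (R n))
    {b : ∀ n, 𝒵 n → ℝ} (hb : ∀ n, Measurable (b n)) {W : ℕ → Ω → ℝ} (hW : ∀ n, Measurable (W n))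
    {D : ℝ} (hD : 0 ≤ D)
    (hgood : ∀ L : ℝ, ∃ B : ℕ → Set Ω, Tendsto (fun n => P (B n)) atTop (𝓝 0) ∧ ∀ n, ∀ ω ∉ B n,
      (R n (Z n ω)).PosSemidef ∧ (1 - R n (Z n ω)).PosSemidef ∧ L ≤ b n (Z n ω) ∧
      (R n (Z n ω) ^ 2).trace ≤ b n (Z n ω) ∧ b n (Z n ω) ≤ (R n (Z n ω) ^ 2).trace + D ∧
      W n ω = (Y n ω ⬝ᵥ R n (Z n ω) *ᵥ Y n ω - (R n (Z n ω)).trace) / √(2 * b n (Z n ω))) :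
    TendstoInDistribution W atTop (id : ℝ → ℝ) (fun _ => P) (gaussianReal 0 1) := by
  refine tendstoInDistribution_gaussianReal_of_conditional_charFun hZ hY hind hlaw
    (h := fun n z e => (e ⬝ᵥ R n z *ᵥ e - (R n z).trace) / √(2 * b n z)) (fun n => ?_) hW
    fun t η hη => ?_
  · have h1 := MeasurableEntries.measurable_quadForm
      (R := fun p : 𝒵 n × (Fin n → ℝ) => R n p.1) ((hRm n).comp measurable_fst)
      measurable_snd
    exact (h1.sub ((hRm n).trace.comp measurable_fst)).div
      (((hb n).comp measurable_fst).const_mul 2).sqrt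
  · obtain ⟨L, -, hL⟩ := exists_norm_charFun_normalized_quadForm_le t D hD hη
    obtain ⟨B, hB0, hB⟩ := hgood L
    refine ⟨B, hB0, fun n ω hω => ?_⟩
    obtain ⟨h1, h2, h3, h4, h5, h6⟩ := hB n ω hω
    exact ⟨h6, hL h1 h2 _ h3 h4 h5⟩

end SketchedKRR

end

/-! ### Asymptotic normality of the statistic -/

theorem theorem4p5 {d : ℕ} {𝒳 : Set (EuclideanSpace ℝ (Fin d))}
    -- the design distribution and the kernel
    (PX : Measure 𝒳) [IsProbabilityMeasure PX]
    (K : 𝒳 → 𝒳 → ℝ) (ev : ℕ → ℝ) (φ : ℕ → 𝒳 → ℝ)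
    (hK : SketchedKRR.IsMercerExpansion PX K ev φ)
    (hreg : SketchedKRR.IsRegularExpansion ev φ)
    -- smoothing parameters and projection dimensions
    (lam : ℕ → ℝ) (hlam_pos : ∀ n, 0 < lam n) (hlam : Tendsto lam atTop (𝓝 0))
    (s : ℕ → ℕ) (hs : Tendsto s atTop atTop)
    -- i.i.d. design points, projection matrices, i.i.d. standard normal noise
    {Ω : Type*} [MeasurableSpace Ω] (P : Measure Ω) [IsProbabilityMeasure P]
    (x : ℕ → Ω → 𝒳) (hx_meas : ∀ i, Measurable (x i)) (hx_indep : iIndepFun x P)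
    (hx_law : ∀ i, P.map (x i) = PX)
    (S : ∀ n, Ω → Fin (s n) → Fin n → ℝ) (hS_meas : ∀ n, Measurable (S n))
    (ε : ℕ → Ω → ℝ) (hε_meas : ∀ i, Measurable (ε i)) (hε_indep : iIndepFun ε P)
    (hε_law : ∀ i, P.map (ε i) = gaussianReal 0 1)
    -- the noise is independent of the design points and the projection matrix
    (hindep : ∀ n, IndepFun (fun ω (i : Fin n) => ε i ω)
      (fun ω => ((fun i : Fin n => x i ω), S n ω)) P)
    -- the standing condition on the projection dimension and the projection matrix
    (c₀ : ℝ) (hc₀ : 0 < c₀)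
    (hdim : ∀ᶠ n in atTop, c₀ * SketchedKRR.popDim ev (lam n) ≤ s n)
    (c : ℝ) (c₁ c₂ : ℝ≥0∞) (hc : 0 < c) (hc₁ : 0 < c₁) (hc₂ : 0 < c₂)
    (hsat : ∀ᶠ n in atTop, SketchedKRR.IsOfType P (fun ω (i : Fin n) => x i ω)
      (c₁ * s n) (c₂ * SketchedKRR.popDim ev (lam n))
      {ω | SketchedKRR.IsKSatisfiable c (lam n)
        (SketchedKRR.kernelMatrix K fun i : Fin n => x i ω) (Matrix.of (S n ω))})
    -- the inverses in the definitions exist with probability tending to one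
    (G : ℕ → Set Ω)
    (hG : ∀ n, G n = {ω | SketchedKRR.IsWellPosed K (fun i : Fin n => x i ω)
      (Matrix.of (S n ω)) (lam n)})
    (hG_prob : Tendsto (fun n => P (G n)) atTop (𝓝 1))
    -- the null hypothesis and the responses
    (f : 𝒳 → ℝ) (hf : SketchedKRR.IsLinearFun f)
    (y : ∀ n, Ω → Fin n → ℝ) (hy : ∀ n ω i, y n ω i = f (x i ω) + ε i ω)
    -- the statistic, its standardization, and the information in `(x, S)`
    (T μs σs vs : ℕ → Ω → ℝ)
    (hT : ∀ n ω, T n ω = SketchedKRR.linStat K (fun i : Fin n => x i ω)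
      (Matrix.of (S n ω)) (lam n) (y n ω))
    (hμs : ∀ n ω, μs n ω = SketchedKRR.linMean K (fun i : Fin n => x i ω)
      (Matrix.of (S n ω)) (lam n))
    (hσs : ∀ n ω, σs n ω = SketchedKRR.linSD K (fun i : Fin n => x i ω)
      (Matrix.of (S n ω)) (lam n))
    (hvs : ∀ n ω, vs n ω = SketchedKRR.linVar K (fun i : Fin n => x i ω)
      (Matrix.of (S n ω)) (lam n))
    (𝓕 : ℕ → MeasurableSpace Ω)
    (h𝓕 : ∀ n, 𝓕 n = MeasurableSpace.comap
      (fun ω => ((fun i : Fin n => x i ω), S n ω)) inferInstance) :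
    -- asymptotic normality
    TendstoInDistribution (fun n ω => (T n ω - μs n ω) / σs n ω) atTop
      (id : ℝ → ℝ) (fun _ => P) (gaussianReal 0 1) ∧
    -- `μs` is the conditional mean given `(x, S)`
    (∀ n, P[(G n).indicator (T n) | 𝓕 n] =ᵐ[P] (G n).indicator (μs n)) ∧
    -- the conditional variance given `(x, S)`, and asymptotic normality for its square root
    (∀ n, Var[(G n).indicator (T n); P | 𝓕 n] =ᵐ[P] (G n).indicator (vs n)) ∧
    TendstoInDistribution (fun n ω => (T n ω - μs n ω) / √(vs n ω)) atTop
      (id : ℝ → ℝ) (fun _ => P) (gaussianReal 0 1) := by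
  have hxn : ∀ n, Measurable fun ω (i : Fin n) => x i ω := fun n =>
    measurable_pi_lambda _ fun i => hx_meas i
  have hY : ∀ n, Measurable fun ω (i : Fin n) => ε i ω := fun n =>
    measurable_pi_lambda _ fun i => hε_meas i
  have hZ : ∀ n, Measurable fun ω => ((fun i : Fin n => x i ω), S n ω) := fun n =>
    (hxn n).prodMk (hS_meas n)
  have hlaw : ∀ n, P.map (fun ω (i : Fin n) => ε i ω) = gaussianPi (Fin n) := fun n => by
    have h := (iIndepFun_iff_map_fun_eq_pi_map fun i : Fin n => (hε_meas i).aemeasurable).1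
      (hε_indep.precomp Fin.val_injective)
    rw [h]
    simp only [hε_law]
  have hK_psd : ∀ n ω, (SketchedKRR.kernelMatrix K fun i : Fin n => x i ω).PosSemidef :=
    fun n ω => hK.kernelMatrix_posSemidef _
  have hRm := fun n => hK.measurableEntries_residualMatrix (n := n) (s := s n) (lam n)
  have hT_noise : ∀ n ω, SketchedKRR.IsWellPosed K (fun i : Fin n => x i ω)
      (Matrix.of (S n ω)) (lam n) → T n ω = ((fun i : Fin n => ε i ω) ⬝ᵥ
        SketchedKRR.residualMatrix K (fun i : Fin n => x i ω) (Matrix.of (S n ω)) (lam n) *ᵥ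
          fun i : Fin n => ε i ω) / n := fun n ω hw => by
    rw [hT]
    exact SketchedKRR.linStat_eq_noise (hK_psd n ω) (hlam_pos n) hw.1 hf (hy n ω)
  have hT_meas : ∀ n, Measurable (T n) := fun n => by
    have hyn : Measurable (y n) := measurable_pi_lambda _ fun i => by
      simp only [hy]
      exact (hf.measurable.comp (hx_meas i)).add (hε_meas i)
    rw [show T n = _ from funext fun ω => hT n ω]
    exact hK.measurable_linStat (hlam_pos n) (hxn n) (hS_meas n) hyn
  have hμ_meas : ∀ n, Measurable (μs n) := fun n => by
    rw [show μs n = _ from funext fun ω => hμs n ω]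
    exact ((hRm n).trace.comp (hZ n)).div_const (n : ℝ)
  have ha_meas := fun n => (hK.measurableEntries_sandwich (n := n) (s := s n) (lam n) 4).trace
  have hv_meas := fun n => ((hRm n).pow 2).trace
  have hσ_meas : ∀ n, Measurable (σs n) := fun n => by
    rw [show σs n = _ from funext fun ω => hσs n ω]
    exact (((ha_meas n).comp (hZ n)).const_mul 2).sqrt.div_const (n : ℝ)
  have hvs_meas : ∀ n, Measurable (vs n) := fun n => by
    rw [show vs n = _ from funext fun ω => hvs n ω]
    exact (((hv_meas n).comp (hZ n)).const_mul 2).div_const ((n : ℝ) ^ 2)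
  have hgood := hK.tendsto_measure_not_le_trace hreg.summable hlam_pos hlam hs hx_meas hx_indep
    hx_law hS_meas hc₁ hc₂ hsat (hG_prob.congr fun n => by rw [hG])
  -- The reduction to noise needs `H` to fix the linear functions, hence the restriction to `G n`.
  have hind_eq : ∀ n, (G n).indicator (T n)
      = ((fun ω => ((fun i : Fin n => x i ω), S n ω)) ⁻¹' {z | SketchedKRR.IsWellPosed K z.1
        (Matrix.of z.2) (lam n)}).indicator fun ω => ((fun i : Fin n => ε i ω) ⬝ᵥ
        SketchedKRR.residualMatrix K (fun i : Fin n => x i ω) (Matrix.of (S n ω)) (lam n) *ᵥ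
          fun i : Fin n => ε i ω) / n := fun n => by
    rw [hG]
    exact Set.indicator_congr fun ω hω => hT_noise n ω hω
  refine ⟨?_, fun n => ?_, fun n => ?_, ?_⟩
  -- Here `b = tr QΔ⁴Q`: it exceeds `tr R²` by at most `D = d + 1` and falls below `tr Δ⁴` by at
  -- most `d + 1`, whence the shifted bound `L + (d + 1)`.
  · refine SketchedKRR.tendstoInDistribution_normalized_quadForm hZ hY hindep hlaw hRm ha_meas
      (fun n => ((hT_meas n).sub (hμ_meas n)).div (hσ_meas n)) (D := d + 1) (by positivity)
      fun L => ⟨_, hgood (L + (d + 1)), fun n ω hω => ?_⟩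
    obtain ⟨hn, hw, hL⟩ := not_not.1 hω
    obtain ⟨h1, h2, h3⟩ := SketchedKRR.trace_comparison (hK_psd n ω) (hlam_pos n) hw.1 hw.2
    refine ⟨SketchedKRR.residualMatrix_posSemidef (hK_psd n ω) (hlam_pos n),
      SketchedKRR.one_sub_residualMatrix_posSemidef (hK_psd n ω) (hlam_pos n) hw.1 hw.2,
      by linarith, h2, h3, ?_⟩
    rw [hT_noise n ω hw, hμs, hσs, SketchedKRR.linMean, SketchedKRR.linSD, ← sub_div,
      div_div_div_cancel_right₀ (Nat.cast_ne_zero.2 hn.ne')]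
    rfl
  · rw [hind_eq, h𝓕]
    refine (SketchedKRR.condExp_indicator_quadForm (hZ n) (hY n) (hindep n) (hlaw n)
      (hK.measurableSet_isWellPosed (lam n)) (hRm n)
      (fun z _ => SketchedKRR.residualMatrix_posSemidef (hK.kernelMatrix_posSemidef _) (hlam_pos n))
      (fun z hz => SketchedKRR.one_sub_residualMatrix_posSemidef (hK.kernelMatrix_posSemidef _)
        (hlam_pos n) hz.1 hz.2)).trans (.of_eq ?_)
    rw [hG]
    exact Set.indicator_congr fun ω _ => (hμs n ω).symm
  · rw [hind_eq, h𝓕]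
    refine (SketchedKRR.condVar_indicator_quadForm (hZ n) (hY n) (hindep n) (hlaw n)
      (hK.measurableSet_isWellPosed (lam n)) (hRm n)
      (fun z _ => SketchedKRR.residualMatrix_posSemidef (hK.kernelMatrix_posSemidef _) (hlam_pos n))
      (fun z hz => SketchedKRR.one_sub_residualMatrix_posSemidef (hK.kernelMatrix_posSemidef _)
        (hlam_pos n) hz.1 hz.2)).trans (.of_eq ?_)
    rw [hG]
    exact Set.indicator_congr fun ω _ => (hvs n ω).symm
  -- Here `b = tr R²` exactly, so `D = 0`; passing from `tr Δ⁴` through `tr QΔ⁴Q` to `tr R²` loses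
  -- `d + 1` twice.
  · refine SketchedKRR.tendstoInDistribution_normalized_quadForm hZ hY hindep hlaw hRm hv_meas
      (fun n => ((hT_meas n).sub (hμ_meas n)).div (hvs_meas n).sqrt) (D := 0) le_rfl
      fun L => ⟨_, hgood (L + 2 * (d + 1)), fun n ω hω => ?_⟩
    obtain ⟨hn, hw, hL⟩ := not_not.1 hω
    obtain ⟨h1, h2, h3⟩ := SketchedKRR.trace_comparison (hK_psd n ω) (hlam_pos n) hw.1 hw.2
    have hR := SketchedKRR.residualMatrix_posSemidef (S := Matrix.of (S n ω)) (hK_psd n ω)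
      (hlam_pos n)
    refine ⟨hR,
      SketchedKRR.one_sub_residualMatrix_posSemidef (hK_psd n ω) (hlam_pos n) hw.1 hw.2,
      ?_, le_rfl, (add_zero _).ge, ?_⟩
    · have : L ≤ (SketchedKRR.residualMatrix K (fun i : Fin n => x i ω) (Matrix.of (S n ω))
        (lam n) ^ 2).trace := by linarith
      exact this
    · have h0 := (hR.pow 2).trace_nonneg
      rw [SketchedKRR.residualMatrix] at h0
      rw [hT_noise n ω hw, hμs, hvs, SketchedKRR.linMean, SketchedKRR.linVar, ← sub_div,
        Real.sqrt_div (mul_nonneg zero_le_two h0), Real.sqrt_sq (Nat.cast_nonneg n),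
        div_div_div_cancel_right₀ (Nat.cast_ne_zero.2 hn.ne')]
      rfl
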